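/- **Setting.** A (finitary) algebraic type $V$ is given by operators of finite arity together with equations between the operators derived from them. $V$ is *self-enhancing* if, for all $V$-algebras $A,B$, the set of homomorphisms $A\to B$ is closed under the pointwise operations (and so is a $V$-algebra, with bilinear composition). Fix a self-enhancing $V$. A *$W$-algebra* is a commutative monoid object in $V$-algebras, that is, a $V$-algebra $R$ with a commutative monoid structure such that $a\cdot\varphi(b_1,\dots,b_n)=\varphi(ab_1,\dots,ab_n)$ for every $n$-ary operator $\varphi$ of $V$; homomorphisms respect both structures. An *ideal* of $R$ is a subset closed under the operators of $V$ and under multiplication by $R$. Finitely generated ideals form a semiring under sum and product, with unit ideal $R$. For a submonoid $S\subseteq R$, $S^{-1}R$ is the localization, and $R_f$ is the localization at the powers of $f$. Distributive lattices have $0$ and $1$, and their homomorphisms preserve them. A *coherent space* is a spectral space, and its morphisms are the quasi-compact continuous maps. For a quasi-compact open $U\subseteq X$, $\Omega_c(U)$ is the lattice of quasi-compact open subsets of $U$, and $\tau_X$ is the sheaf of distributive lattices $U\mapsto\Omega_c(U)$ on $X$. Sheaves on $X$ are sheaves on its quasi-compact open subsets. Given a functor $L$ from $W$-algebras to distributive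 lattices and a sheaf $\mathcal O$ of $W$-algebras, $L\mathcal O$ denotes the sheafification of $U\mapsto L(\mathcal O(U))$. Consider triples $(X,\mathcal O_X,\beta_X)$, where $X$ is a coherent space, $\mathcal O_X$ a sheaf of $W$-algebras on $X$, and $\beta_X:L\mathcal O_X\to\tau_X$ a morphism of sheaves of distributive lattices. A morphism $(X,\mathcal O_X,\beta_X)\to(Y,\mathcal O_Y,\beta_Y)$ is a pair $(f,f^\#)$ of a quasi-compact continuous map $f:X\to Y$ and a morphism $f^\#:\mathcal O_Y\to f_*\mathcal O_X$ of sheaves of $W$-algebras such that the two composites $L\mathcal O_Y\to f_*L\mathcal O_X\to f_*\tau_X$ (from $f^\#$ and $f_*\beta_X$) and $L\mathcal O_Y\to\tau_Y\to f_*\tau_X$ (from $\beta_Y$ and $T\mapsto f^{-1}(T)$) coincide. **$\mathscr A$-schemes.** Let $\alpha_1(R)$ be the set of finitely generated ideals of $R$ modulo the relation $\mathfrak a\equiv\mathfrak b\iff\mathfrak a^n\subseteq\mathfrak b$ and $\mathfrak b^n\subseteq\mathfrak a$ for $n\gg0$. It is a distributive lattice with join and meet induced by sum and product. Let $\alpha_2:R\to\alpha_1(R)$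 send $a$ to the class of the principal ideal generated by $a$. Both are natural in $R$ and, for every submonoid $S$, $\alpha_1(R)\to\alpha_1(S^{-1}R)$ identifies $\alpha_1(S^{-1}R)$ with the localization of $\alpha_1(R)$ at $\alpha_2(S)$ (call this identification $\gamma$), so $\mathscr A=(W,\alpha_1,\alpha_2,\gamma)$ is a schematizable algebraic type. An *$\mathscr A$-scheme* is a triple as above with $L=\alpha_1$ such that, for all quasi-compact open $T\subseteq U$, the restriction $\mathcal O_X(U)\to\mathcal O_X(T)$ factors through the localization of $\mathcal O_X(U)$ by the multiplicative system $\{f\in\mathcal O_X(U)\mid\beta_X(\alpha_2(f))\supseteq T\}$. **Weak $\mathscr C$-schemes.** Let $\mathscr C$ be the opposite of the category of $W$-algebras, with its *Zariski topology*: $\mathscr E$ consists of the localizations of finite type $S^{-1}R\to R$ (with $S$ finitely generated), and the coverings of $R$ are the finite sets $\{R_{f_i}\to R\}_i$ of $\mathscr E$-morphisms such that the $f_i$ generate the unit ideal. Let $\Omega_1(R)$ be the set of finite sets of $\mathscr E$-morphisms to $R$, ordered by $$\{U_i\}_i\prec\{V_j\}_j\iff\{U_i\times_RV_j\to U_i\}_j\text{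 is a covering of }U_i\text{ for every }i,$$ modulo the equivalence $x\prec y\prec x$. It is a distributive lattice with join $\{U_i\}_{i\in I\amalg J}$ and meet $\{U_i\times_RV_j\}_{i,j}$, functorial in $R$ by base change. A *weak $\mathscr C$-scheme* is a triple as above with $L=\Omega_1$ such that, for all quasi-compact open $T\subseteq U$ and every $\mathscr E$-morphism $j:A\to\mathcal O_X(U)$ with $\beta_X(U)(\{j\})\supseteq T$, the restriction, as a morphism $\mathcal O_X(T)\to\mathcal O_X(U)$ of $\mathscr C$, factors through $j$. **Theorem 4.16.** For every self-enhancing algebraic type $V$, the category of $\mathscr A$-schemes is equivalent to the category of weak $\mathscr C$-schemes. -/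

import Mathlib

open CategoryTheory Opposite TopologicalSpace
universe u

noncomputable section

/-! ### Sheafification of lattice-valued presheaves -/
namespace DLat

/-- A bounded distributive lattice, regarded as a semiring with `+ = ⊔` and `* = ⊓`. -/
def AsSemiring (L : Type u) : Type u := L

instance (L : Type u) [DistribLattice L] [BoundedOrder L] : CommSemiring (AsSemiring L) where
  add a b := (max a b : L)
  mul a b := (min a b : L)
  zero := (⊥ : L)
  one := (⊤ : L)
  nsmul n a := Nat.rec (⊥ : L) (fun _ b => (max b a : L)) n
  npow n a := Nat.rec (⊤ : L) (fun _ b => (min b a : L)) n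
  nsmul_zero _ := rfl
  nsmul_succ _ _ := rfl
  npow_zero _ := rfl
  npow_succ _ _ := rfl
  add_assoc := sup_assoc (α := L)
  zero_add := bot_sup_eq (α := L)
  add_zero := sup_bot_eq (α := L)
  add_comm := sup_comm (α := L)
  left_distrib := inf_sup_left (α := L)
  right_distrib := inf_sup_right (α := L)
  zero_mul := bot_inf_eq (α := L)
  mul_zero := inf_bot_eq (α := L)
  mul_assoc := inf_assoc (α := L)
  one_mul := top_inf_eq (α := L)
  mul_one := inf_top_eq (α := L)
  mul_comm := inf_comm (α := L)

/-- The fully faithful functor from bounded distributive lattices to commutative semirings. -/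
def toSemiring : BddDistLat.{u} ⥤ CommSemiRingCat.{u} where
  obj L := CommSemiRingCat.of (AsSemiring L)
  map f := CommSemiRingCat.ofHom
    { toFun := fun x => f x
      map_one' := map_top f.hom
      map_zero' := map_bot f.hom
      map_mul' := f.hom.map_inf'
      map_add' := f.hom.map_sup' }

instance : toSemiring.{u}.Faithful where
  map_injective {X Y f g} h := by
    ext x
    exact congrArg (fun k => k.hom x) h

instance : toSemiring.{u}.Full where
  map_surjective g := ⟨BddDistLat.ofHom
    { toFun := fun x => g.hom x
      map_top' := g.hom.map_one
      map_bot' := g.hom.map_zero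
      map_inf' := g.hom.map_mul
      map_sup' := g.hom.map_add }, rfl⟩

/-- A commutative semiring with `x * x = x` and `1 + x = 1` is a bounded distributive lattice. -/
@[reducible] def latticeOfSemiring (R : Type u) [CommSemiring R] (h1 : ∀ x : R, x * x = x)
    (h2 : ∀ x : R, 1 + x = 1) : DistribLattice R :=
  have h3 : ∀ x y : R, x + x * y = x := fun x y => by
    rw [← mul_one_add, h2, mul_one]
  letI : Max R := ⟨(· + ·)⟩
  letI : Min R := ⟨(· * ·)⟩
  letI l : Lattice R := Lattice.mk' (fun a b => add_comm a b) (fun a b c => add_assoc a b c)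
    (fun a b => mul_comm a b) (fun a b c => mul_assoc a b c) (fun a b => h3 a b)
    (fun a b => by change a * (a + b) = a; rw [mul_add, h1, h3])
  DistribLattice.ofInfSupLe fun a b c => (mul_add a b c).le

/-- The bounds of the lattice `latticeOfSemiring`. -/
@[reducible] def boundedOfSemiring (R : Type u) [CommSemiring R] (h1 : ∀ x : R, x * x = x)
    (h2 : ∀ x : R, 1 + x = 1) :
    letI := latticeOfSemiring R h1 h2
    BoundedOrder R :=
  letI := latticeOfSemiring R h1 h2
  { top := 1
    bot := 0
    le_top := fun a => inf_eq_left.mp (mul_one a)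
    bot_le := fun a => sup_eq_right.mp (zero_add a) }

lemma exists_iso (R : CommSemiRingCat.{u}) (h1 : ∀ x : R, x * x = x) (h2 : ∀ x : R, 1 + x = 1) :
    ∃ L : BddDistLat.{u}, Nonempty (toSemiring.obj L ≅ R) := by
  let := latticeOfSemiring R h1 h2
  let := boundedOfSemiring R h1 h2
  refine ⟨BddDistLat.of R, ⟨RingEquiv.toCommSemiRingCatIso
    (R := CommSemiRingCat.of (AsSemiring R)) (S := R)
    { toFun := fun x => x
      invFun := fun x => x
      left_inv := fun _ => rfl
      right_inv := fun _ => rfl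
      map_mul' := fun _ _ => rfl
      map_add' := fun _ _ => rfl }⟩⟩

lemma idem (L : BddDistLat.{u}) (x : toSemiring.obj L) : x * x = x := inf_idem (α := L) x
lemma absorb (L : BddDistLat.{u}) (x : toSemiring.obj L) : 1 + x = 1 := top_sup_eq (α := L) x

open Limits

variable {J : Type u} [SmallCategory J]

instance (F : J ⥤ BddDistLat.{u}) : CreatesLimit F toSemiring.{u} := by
  have h := exists_iso (limit (F ⋙ toSemiring))
    (fun x => Concrete.limit_ext _ _ _ fun j => by
      simpa using idem (F.obj j) (limit.π (F ⋙ toSemiring) j x))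
    (fun x => Concrete.limit_ext _ _ _ fun j => by
      simpa using absorb (F.obj j) (limit.π (F ⋙ toSemiring) j x))
  exact createsLimitOfFullyFaithfulOfIso h.choose h.choose_spec.some

instance [IsFiltered J] : HasColimitsOfShape J CommSemiRingCat.{u} where
  has_colimit F := ⟨⟨_, CommSemiRingCat.FilteredColimits.colimitCoconeIsColimit.{u, u} F⟩⟩

instance [IsFiltered J] (F : J ⥤ BddDistLat.{u}) : CreatesColimit F toSemiring.{u} := by
  have h := exists_iso (colimit (F ⋙ toSemiring))
    (fun x => by
      obtain ⟨j, y, rfl⟩ := Concrete.colimit_exists_rep _ x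
      rw [← map_mul]; exact congrArg _ (idem (F.obj j) y))
    (fun x => by
      obtain ⟨j, y, rfl⟩ := Concrete.colimit_exists_rep _ x
      rw [← map_one (colimit.ι (F ⋙ toSemiring) j).hom, ← map_add]
      exact congrArg _ (absorb (F.obj j) y))
  exact createsColimitOfFullyFaithfulOfIso h.choose h.choose_spec.some

instance : HasLimitsOfShape J BddDistLat.{u} where
  has_limit F := hasLimit_of_created F toSemiring

instance [IsFiltered J] : HasColimitsOfShape J BddDistLat.{u} where
  has_colimit F := hasColimit_of_created F toSemiring

instance : HasLimits BddDistLat.{u} where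

/-- The two underlying-set functors agree. -/
def forgetIso : toSemiring.{u} ⋙ forget CommSemiRingCat.{u} ≅ forget BddDistLat.{u} := Iso.refl _

instance : PreservesLimits (forget BddDistLat.{u}) where
  preservesLimitsOfShape :=
    { preservesLimit := fun {F} =>
        preservesLimit_of_natIso (h := forgetIso) F }

instance [IsFiltered J] : PreservesColimitsOfShape J (forget BddDistLat.{u}) where
  preservesColimit {F} := preservesColimit_of_natIso (h := forgetIso) F

instance : (forget BddDistLat.{u}).ReflectsIsomorphisms where
  reflects {X Y} f hf := by
    have : IsIso ((toSemiring ⋙ forget CommSemiRingCat).map f) := hf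
    exact isIso_of_reflects_iso f (toSemiring ⋙ forget CommSemiRingCat)

variable {C : Type u} [SmallCategory C] (J : GrothendieckTopology C)

instance : HasSheafify J BddDistLat.{u} := inferInstance

end DLat
/-! ### Coherent spaces and sheaves on their quasi-compact open subsets -/
namespace Coh

variable (X : Type u) [TopologicalSpace X] [SpectralSpace X]

instance : DistribLattice (CompactOpens X) :=
  { (inferInstance : SemilatticeSup (CompactOpens X)),
    (inferInstance : SemilatticeInf (CompactOpens X)) with
    le_sup_inf := fun a b c x hx => by
      rcases hx with ⟨h1 | h1, h2 | h2⟩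
      · exact Or.inl h1
      · exact Or.inl h1
      · exact Or.inl h2
      · exact Or.inr ⟨h1, h2⟩ }

lemma exists_compactOpens (U : Set X) (hU : IsOpen U) (x : X) (hx : x ∈ U) :
    ∃ W : CompactOpens X, x ∈ W ∧ (W : Set X) ⊆ U := by
  obtain ⟨W, ⟨h1, h2⟩, h3, h4⟩ :=
    (PrespectralSpace.isTopologicalBasis (X := X)).exists_subset_of_mem_open hx hU
  exact ⟨⟨⟨W, h2⟩, h1⟩, h3, h4⟩

/-- The Grothendieck topology on the poset of quasi-compact open subsets of a coherent space: a
sieve on `U` is covering if its members have union `U` (equivalently, since `U` is quasi-compact,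
if finitely many of its members have union `U`). -/
def topology : GrothendieckTopology (CompactOpens X) where
  sieves U := {S | ∀ x ∈ U, ∃ (V : CompactOpens X) (f : V ⟶ U), S f ∧ x ∈ V}
  top_mem' U := fun x hx => ⟨U, 𝟙 U, trivial, hx⟩
  pullback_stable' U V S f hS := fun x hx => by
    obtain ⟨W, g, hg, hW⟩ := hS x (leOfHom f hx)
    exact ⟨W ⊓ V, homOfLE inf_le_right,
      S.downward_closed hg (homOfLE (inf_le_left : W ⊓ V ≤ W)), hW, hx⟩
  transitive' U S hS R hR := fun x hx => by
    obtain ⟨V, f, hf, hV⟩ := hS x hx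
    obtain ⟨W, g, hg, hW⟩ := hR hf x hV
    exact ⟨W, g ≫ f, hg, hW⟩

/-- The lattice `Ω_c(U)` of the quasi-compact open subsets of the quasi-compact open `U`. -/
def Below {X : Type u} [TopologicalSpace X] (U : CompactOpens X) : Type u :=
  {W : CompactOpens X // W ≤ U}

variable {X} in
instance (U : CompactOpens X) : DistribLattice (Below U) :=
  letI : Max (Below U) := ⟨fun a b => ⟨a.1 ⊔ b.1, sup_le a.2 b.2⟩⟩
  letI : Min (Below U) := ⟨fun a b => ⟨a.1 ⊓ b.1, inf_le_left.trans a.2⟩⟩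
  letI : LE (Below U) := ⟨fun a b => a.1 ≤ b.1⟩
  letI : LT (Below U) := ⟨fun a b => a.1 < b.1⟩
  Subtype.val_injective.distribLattice (fun a : Below U => a.1) Iff.rfl Iff.rfl
    (fun _ _ => rfl) (fun _ _ => rfl)

variable {X} in
instance (U : CompactOpens X) : BoundedOrder (Below U) where
  top := ⟨U, le_rfl⟩
  bot := ⟨⊥, bot_le⟩
  le_top a := a.2
  bot_le a := (bot_le : ⊥ ≤ a.1)

/-- The presheaf `U ↦ Ω_c(U)`, with restriction maps `W ↦ W ∩ V`. -/
def tauPresheaf : (CompactOpens X)ᵒᵖ ⥤ BddDistLat.{u} where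
  obj U := BddDistLat.of (Below U.unop)
  map {U V} f := BddDistLat.ofHom
    { toFun := fun W => ⟨W.1 ⊓ V.unop, inf_le_right⟩
      map_sup' := fun a b => Subtype.ext (inf_sup_right a.1 b.1 V.unop)
      map_inf' := fun a b => Subtype.ext (inf_inf_distrib_right a.1 b.1 V.unop)
      map_top' := Subtype.ext (inf_eq_right.mpr (leOfHom f.unop))
      map_bot' := Subtype.ext (bot_inf_eq _) }
  map_id U := by
    ext W
    exact Subtype.ext (inf_eq_left.mpr W.2)
  map_comp {U V T} f g := by
    ext W
    refine Subtype.ext ?_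
    change W.1 ⊓ T.unop = W.1 ⊓ V.unop ⊓ T.unop
    rw [inf_assoc, inf_eq_right.mpr (leOfHom g.unop)]

lemma tau_isSheaf : Presheaf.IsSheaf (topology X) (tauPresheaf X) := by
  rw [Presheaf.isSheaf_iff_isSheaf_forget _ _ (forget BddDistLat.{u})]
  rw [isSheaf_iff_isSheaf_of_type]
  intro U S hS x hx
  have key : ∀ (V V' : CompactOpens X) (f : V ⟶ U) (f' : V' ⟶ U) (h : S f) (h' : S f'),
      (x f h).1 ⊓ V' = (x f' h').1 ⊓ V := by
    intro V V' f f' h h'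
    have := hx (homOfLE (inf_le_left : V ⊓ V' ≤ V)) (homOfLE (inf_le_right : V ⊓ V' ≤ V')) h h'
      (Subsingleton.elim _ _)
    have := congrArg Subtype.val this
    change (x f h).1 ⊓ (V ⊓ V') = (x f' h').1 ⊓ (V ⊓ V') at this
    rw [← inf_assoc, inf_eq_left.mpr (x f h).2, inf_comm V, ← inf_assoc,
      inf_eq_left.mpr (x f' h').2] at this
    exact this
  choose! V f hf hV using hS
  have hU : (U : Set X) ⊆ ⋃ p : {p // p ∈ U}, (V p.1 : Set X) := fun p hp =>
    Set.mem_iUnion.mpr ⟨⟨p, hp⟩, hV p hp⟩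
  obtain ⟨t, ht⟩ := U.isCompact.elim_finite_subcover _ (fun p : {p // p ∈ U} => (V p.1).isOpen) hU
  let W : CompactOpens X := t.sup fun p => (x (f p.1 p.2) (hf p.1 p.2)).1
  have hmem : ∀ p, p ∈ W ↔ ∃ q ∈ t, p ∈ (x (f q.1 q.2) (hf q.1 q.2)).1 := fun p => by
    rw [← SetLike.mem_coe, CompactOpens.coe_finsetSup]; simp
  have hWU : W ≤ U := Finset.sup_le fun p _ => (x (f p.1 p.2) (hf p.1 p.2)).2.trans
    (leOfHom (f p.1 p.2))
  refine ⟨⟨W, hWU⟩, ?_, ?_⟩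
  · intro T g hg
    refine Subtype.ext (SetLike.ext fun p => ?_)
    change p ∈ W ∧ p ∈ T ↔ _
    constructor
    · rintro ⟨h1, h2⟩
      obtain ⟨q, hq, h3⟩ := (hmem p).mp h1
      have : p ∈ (x (f q.1 q.2) (hf q.1 q.2)).1 ⊓ T := ⟨h3, h2⟩
      rw [key _ _ _ g _ hg] at this
      exact this.1
    · intro h1
      have h2 : p ∈ T := (x g hg).2 h1
      obtain ⟨q, hq⟩ := Set.mem_iUnion.mp (ht (leOfHom g h2))
      obtain ⟨hqt, h3⟩ := Set.mem_iUnion.mp hq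
      refine ⟨(hmem p).mpr ⟨q, hqt, ?_⟩, h2⟩
      have : p ∈ (x g hg).1 ⊓ V q.1 := ⟨h1, h3⟩
      rw [key _ _ g (f q.1 q.2) hg (hf q.1 q.2)] at this
      exact this.1
  · intro W' hW'
    refine Subtype.ext (SetLike.ext fun p => ?_)
    have hr : ∀ q (hq : q ∈ U), W'.1 ⊓ V q = (x (f q hq) (hf q hq)).1 := fun q hq =>
      congrArg Subtype.val (hW' (f q hq) (hf q hq))
    rw [hmem]
    constructor
    · intro h1
      have h2 : p ∈ U := W'.2 h1
      obtain ⟨q, hq⟩ := Set.mem_iUnion.mp (ht h2)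
      obtain ⟨hqt, h3⟩ := Set.mem_iUnion.mp hq
      refine ⟨q, hqt, ?_⟩
      rw [← hr]
      exact ⟨h1, h3⟩
    · rintro ⟨q, _, h⟩
      rw [← hr] at h
      exact h.1

/-- The canonical sheaf of distributive lattices `τ` on a coherent space. -/
def tau : Sheaf (topology X) BddDistLat.{u} := ⟨tauPresheaf X, tau_isSheaf X⟩

variable {X} {Y Z : Type u} [TopologicalSpace Y] [SpectralSpace Y]
  [TopologicalSpace Z] [SpectralSpace Z]

/-- The preimage of a quasi-compact open subset under a quasi-compact continuous map. -/
def preimage (f : X → Y) (hf : IsSpectralMap f) (U : CompactOpens Y) : CompactOpens X :=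
  ⟨⟨f ⁻¹' U, hf.isCompact_preimage_of_isOpen U.isOpen U.isCompact⟩,
    U.isOpen.preimage hf.continuous⟩

/-- The preimage functor on quasi-compact open subsets. -/
def preimageFunctor (f : X → Y) (hf : IsSpectralMap f) : CompactOpens Y ⥤ CompactOpens X where
  obj U := preimage f hf U
  map h := homOfLE (fun _ hx => leOfHom h hx)

instance (f : X → Y) (hf : IsSpectralMap f) :
    (preimageFunctor f hf).IsContinuous (topology Y) (topology X) := by
  refine Functor.isContinuous_of_coverPreserving ⟨?_⟩ ⟨?_⟩
  · intro F Z T x hx Y₁ Y₂ W f₁ f₂ g₁ g₂ h₁ h₂ _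
    have hW : W ≤ preimage f hf (Y₁ ⊓ Y₂) := le_inf (leOfHom f₁) (leOfHom f₂)
    have := hx (homOfLE (inf_le_left : Y₁ ⊓ Y₂ ≤ Y₁)) (homOfLE (inf_le_right : Y₁ ⊓ Y₂ ≤ Y₂))
      h₁ h₂ (Subsingleton.elim _ _)
    have := congrArg (F.obj.map (homOfLE hW :
      W ⟶ (preimageFunctor f hf).obj (Y₁ ⊓ Y₂)).op) this
    simp only [Functor.comp_map, ← types_comp_apply, ← Functor.map_comp] at this
    exact this
  · intro _ S hS x hx
    obtain ⟨V, g, hg, hV⟩ := hS (f x) hx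
    exact ⟨preimage f hf V, (preimageFunctor f hf).map g,
      Sieve.image_mem_functorPushforward _ _ hg, hV⟩

/-- The direct image of a sheaf under a quasi-compact continuous map. -/
abbrev pushforward {D : Type (u + 1)} [Category.{u} D] (f : X → Y) (hf : IsSpectralMap f) :
    Sheaf (topology X) D ⥤ Sheaf (topology Y) D :=
  (preimageFunctor f hf).sheafPushforwardContinuous D (topology Y) (topology X)

/-- The morphism `f⁻¹ : τ_Y → f_* τ_X`, given by `Ω_c(U) → Ω_c(f⁻¹ U)`, `V ↦ f⁻¹ V`. -/
def tauMap (f : X → Y) (hf : IsSpectralMap f) : tau Y ⟶ (pushforward f hf).obj (tau X) where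
  hom :=
    { app := fun _ => BddDistLat.ofHom
        { toFun := fun W => ⟨preimage f hf W.1, fun _ hx => W.2 hx⟩
          map_sup' := fun _ _ => rfl
          map_inf' := fun _ _ => rfl
          map_top' := rfl
          map_bot' := rfl }
      naturality := fun _ _ _ => rfl }

end Coh
/-! ### Coherent spaces with a structure sheaf and a support morphism -/
namespace Coh

variable {D : Type (u + 1)} [Category.{u} D] (L : D ⥤ BddDistLat.{u})

section
variable {X Y : Type u} [TopologicalSpace X] [SpectralSpace X] [TopologicalSpace Y]
  [SpectralSpace Y]

/-- The sheaf of distributive lattices obtained by applying `L` to a `D`-valued sheaf, namely the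
sheafification of `U ↦ L (O U)`. -/
def latticeSheaf (O : Sheaf (topology X) D) : Sheaf (topology X) BddDistLat.{u} :=
  (presheafToSheaf (topology X) BddDistLat.{u}).obj (O.obj ⋙ L)

/-- The canonical map from `L (O U)` to the sections over `U` of the sheafification. -/
def toLatticeSheaf (O : Sheaf (topology X) D) : O.obj ⋙ L ⟶ (latticeSheaf L O).obj :=
  toSheafify (topology X) (O.obj ⋙ L)

/-- The map of lattice sheaves induced by a map `O_Y → f_* O_X`, given on presheaves by
`L (O_Y U) → L (O_X (f⁻¹ U))`. -/
def latticeSheafMap (f : X → Y) (hf : IsSpectralMap f) {OY : Sheaf (topology Y) D}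
    {OX : Sheaf (topology X) D} (φ : OY ⟶ (pushforward f hf).obj OX) :
    latticeSheaf L OY ⟶ (pushforward f hf).obj (latticeSheaf L OX) :=
  ⟨sheafifyLift (topology Y)
    (Functor.whiskerRight φ.hom L ≫
      Functor.whiskerLeft (preimageFunctor f hf).op (toLatticeSheaf L OX))
    ((pushforward f hf).obj (latticeSheaf L OX)).property⟩

/-- The quasi-compact open subset `β(U)(a)` of `U`, for `a ∈ L (O U)`. -/
def supp {O : Sheaf (topology X) D} (β : latticeSheaf L O ⟶ tau X) {U : CompactOpens X}
    (a : L.obj (O.obj.obj (op U))) : CompactOpens X :=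
  Subtype.val (p := fun W => W ≤ U) (β.hom.app (op U) ((toLatticeSheaf L O).app (op U) a))

lemma comm_iff (f : X → Y) (hf : IsSpectralMap f) {OY : Sheaf (topology Y) D}
    {OX : Sheaf (topology X) D} (φ : OY ⟶ (pushforward f hf).obj OX)
    (βY : latticeSheaf L OY ⟶ tau Y) (βX : latticeSheaf L OX ⟶ tau X) :
    latticeSheafMap L f hf φ ≫ (pushforward f hf).map βX = βY ≫ tauMap f hf ↔
      ∀ (U : CompactOpens Y) (a : L.obj (OY.obj.obj (op U))),
        supp L βX (U := preimage f hf U) (L.map (φ.hom.app (op U)) a) =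
          preimage f hf (supp L βY a) := by
  have h1 : toLatticeSheaf L OY ≫ (latticeSheafMap L f hf φ).hom =
      Functor.whiskerRight φ.hom L ≫
        Functor.whiskerLeft (preimageFunctor f hf).op (toLatticeSheaf L OX) :=
    toSheafify_sheafifyLift _ _ _
  have h2 : ∀ (U : CompactOpens Y) (a : L.obj (OY.obj.obj (op U))),
      (latticeSheafMap L f hf φ).hom.app (op U) ((toLatticeSheaf L OY).app (op U) a) =
      (toLatticeSheaf L OX).app (op (preimage f hf U)) (L.map (φ.hom.app (op U)) a) :=
    fun U a => congrArg (fun k => k.app (op U) a) h1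
  constructor
  · intro h U a
    have h3 := congrArg (fun k => k.hom.app (op U) ((toLatticeSheaf L OY).app (op U) a)) h
    have h4 := congrArg (βX.hom.app (op (preimage f hf U))) (h2 U a)
    exact congrArg Subtype.val (h4.symm.trans h3)
  · intro h
    refine Sheaf.hom_ext (sheafify_hom_ext _ _ _ ((pushforward f hf).obj (tau X)).property ?_)
    ext U a
    have h4 := congrArg (βX.hom.app (op (preimage f hf U.unop))) (h2 U.unop a)
    exact h4.trans (Subtype.ext (h U.unop a))

end

/-- A coherent space `X` with a `D`-valued sheaf `O` and a morphism `β : L O → τ` of sheaves of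
distributive lattices, the support morphism. -/
structure SupportedSpace where
  carrier : Type u
  [topologicalSpace : TopologicalSpace carrier]
  [spectralSpace : SpectralSpace carrier]
  O : Sheaf (topology carrier) D
  β : latticeSheaf L O ⟶ tau carrier

attribute [instance] SupportedSpace.topologicalSpace SupportedSpace.spectralSpace

namespace SupportedSpace

variable {L}

/-- The quasi-compact open subset `β_X(U)(a)` of `U`, for `a ∈ L (O_X(U))`. -/
abbrev support (X : SupportedSpace L) {U : CompactOpens X.carrier}
    (a : L.obj (X.O.obj.obj (op U))) : CompactOpens X.carrier :=
  supp L X.β a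

/-- A morphism `(f, f^♯)`: a quasi-compact continuous map and a map `f^♯ : O_Y → f_* O_X` of
sheaves that are compatible with the support morphisms. -/
@[ext]
structure Hom (X Y : SupportedSpace L) where
  base : X.carrier → Y.carrier
  isSpectralMap : IsSpectralMap base
  sharp : Y.O ⟶ (pushforward base isSpectralMap).obj X.O
  comm : latticeSheafMap L base isSpectralMap sharp ≫ (pushforward base isSpectralMap).map X.β =
    Y.β ≫ tauMap base isSpectralMap

/-- The identity morphism. -/
def Hom.id (X : SupportedSpace L) : Hom X X where
  base := _root_.id
  isSpectralMap := isSpectralMap_id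
  sharp := ⟨𝟙 X.O.obj⟩
  comm := by
    rw [comm_iff]
    intro U a
    exact congrArg (fun k => supp L X.β (k a)) (L.map_id _)

/-- The composite of two morphisms. -/
def Hom.comp {X Y Z : SupportedSpace L} (f : Hom X Y) (g : Hom Y Z) : Hom X Z where
  base := g.base ∘ f.base
  isSpectralMap := g.isSpectralMap.comp f.isSpectralMap
  sharp := ⟨g.sharp.hom ≫ ((pushforward g.base g.isSpectralMap).map f.sharp).hom⟩
  comm := by
    have hf := (comm_iff L _ _ _ _ _).mp f.comm
    have hg := (comm_iff L _ _ _ _ _).mp g.comm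
    rw [comm_iff]
    intro U a
    have h1 := hf (preimage g.base g.isSpectralMap U) (L.map (g.sharp.hom.app (op U)) a)
    have h2 := congrArg (preimage f.base f.isSpectralMap) (hg U a)
    refine Eq.trans ?_ (h1.trans h2)
    exact congrArg (fun k => supp L X.β (U := preimage f.base f.isSpectralMap
      (preimage g.base g.isSpectralMap U)) (k a)) (L.map_comp _ _)

instance : Category (SupportedSpace L) where
  Hom := Hom
  id := Hom.id
  comp := Hom.comp
  id_comp _ := Hom.ext rfl (heq_of_eq (Sheaf.hom_ext (Category.comp_id _)))
  comp_id _ := Hom.ext rfl (heq_of_eq (Sheaf.hom_ext (Category.id_comp _)))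
  assoc f g h := Hom.ext rfl (heq_of_eq (Sheaf.hom_ext (Category.assoc h.sharp.hom
    ((pushforward h.base h.isSpectralMap).map g.sharp).hom ((pushforward h.base h.isSpectralMap).map
      ((pushforward g.base g.isSpectralMap).map f.sharp)).hom).symm))

end SupportedSpace
end Coh
/-! ### Algebraic types -/

/-- The terms in `n` variables over the graded set `Ω` of operators, that is, the `n`-ary derived
operators generated by `Ω`. -/
inductive OpTerm (Ω : ℕ → Type u) (n : ℕ) : Type u
  | var (i : Fin n) : OpTerm Ω n
  | app {k : ℕ} (φ : Ω k) (t : Fin k → OpTerm Ω n) : OpTerm Ω n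

/-- The value of a derived operator on a set on which the operators act. -/
def OpTerm.eval {Ω : ℕ → Type u} {A : Type u} (op : ∀ {k : ℕ}, Ω k → (Fin k → A) → A) {n : ℕ}
    (x : Fin n → A) : OpTerm Ω n → A
  | .var i => x i
  | .app φ t => op φ fun i => (t i).eval op x

/-- A finitary algebraic type: a graded set of operators, with an equivalence relation on the set
of `n`-ary derived operators for each `n`. -/
structure AlgType : Type (u + 1) where
  Op : ℕ → Type u
  rel : ∀ n : ℕ, Setoid (OpTerm Op n)

namespace AlgType

/-- The structure of a `V`-algebra on a set. -/
class VAlgebra (V : AlgType.{u}) (A : Type u) where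
  op : ∀ {n : ℕ}, V.Op n → (Fin n → A) → A
  eval_eq : ∀ {n : ℕ} (s t : OpTerm V.Op n), V.rel n s t →
    ∀ x : Fin n → A, s.eval op x = t.eval op x

open AlgType.VAlgebra (op)

variable (V : AlgType.{u})

/-- Homomorphisms of `V`-algebras. -/
def IsHom {A B : Type u} [VAlgebra V A] [VAlgebra V B] (f : A → B) : Prop :=
  ∀ (n : ℕ) (φ : V.Op n) (x : Fin n → A), f (op φ x) = op φ fun i => f (x i)

/-- `V` has the self enhancing property: for any `V`-algebras `A` and `B`, the set of homomorphisms
`A → B` is a `V`-algebra under the pointwise operations, that is, it is closed under them. The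
equations of `V` and the bilinearity of the composition are then automatic. -/
def SelfEnhancing : Prop :=
  ∀ (A B : Type u) [VAlgebra V A] [VAlgebra V B] (n : ℕ) (φ : V.Op n) (f : Fin n → A → B),
    (∀ i, IsHom V (f i)) → IsHom V fun a => op φ fun i => f i a

/-- The structure of a `W`-algebra on a commutative multiplicative monoid, where `W` is the type of
commutative monoid objects in `V`-algebras: a structure of a `V`-algebra for which the
multiplication distributes over all operators. -/
class CMonAlgebra (R : Type u) [CommMonoid R] extends VAlgebra V R where
  mul_op : ∀ {n : ℕ} (a : R) (φ : V.Op n) (x : Fin n → R), a * op φ x = op φ fun i => a * x i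

end AlgType

/-- A `W`-algebra, for `W` the type of commutative monoid objects in `V`-algebras. -/
structure WAlg (V : AlgType.{u}) : Type (u + 1) where
  carrier : Type u
  [commMonoid : CommMonoid carrier]
  [alg : V.CMonAlgebra carrier]

namespace WAlg

variable {V : AlgType.{u}}

instance : CoeSort (WAlg V) (Type u) := ⟨carrier⟩

attribute [instance] commMonoid alg

open AlgType AlgType.VAlgebra

/-- A homomorphism of `W`-algebras. -/
@[ext]
structure Hom (R S : WAlg V) where
  hom : R →* S
  isHom : IsHom V hom

instance : Category (WAlg V) where
  Hom := Hom
  id R := ⟨MonoidHom.id R, fun _ _ _ => rfl⟩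
  comp f g := ⟨g.hom.comp f.hom, fun _ φ x => by
    change g.hom (f.hom _) = _
    rw [f.isHom, g.isHom]
    rfl⟩

@[ext] lemma hom_ext {R S : WAlg V} {f g : R ⟶ S} (h : ∀ x, f.hom x = g.hom x) : f = g :=
  Hom.ext (MonoidHom.ext h)

@[simp] lemma id_hom (R : WAlg V) (x : R) : Hom.hom (𝟙 R) x = x := rfl
@[simp] lemma comp_hom {R S T : WAlg V} (f : R ⟶ S) (g : S ⟶ T) (x : R) :
    (f ≫ g).hom x = g.hom (f.hom x) := rfl

/-! ### Localization -/

section Localization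

variable {R : WAlg V} (S : Submonoid R)

lemma exists_common {n : ℕ} (z : Fin n → Localization S) :
    ∃ (x : Fin n → R) (s : S), ∀ i, z i = Localization.mk (x i) s := by
  have h : ∀ i, ∃ p : R × S, z i = Localization.mk p.1 p.2 := fun i => by
    induction z i using Localization.induction_on with
    | H p => exact ⟨p, rfl⟩
  choose p hp using h
  refine ⟨fun i => ((∏ j ∈ Finset.univ.erase i, (p j).2 : S) : R) * (p i).1, ∏ j, (p j).2,
    fun i => ?_⟩
  rw [hp, Localization.mk_eq_mk_iff, Localization.r_iff_exists]
  refine ⟨1, ?_⟩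
  rw [← Finset.mul_prod_erase Finset.univ (fun j => (p j).2) (Finset.mem_univ i)]
  simp only [OneMemClass.coe_one, one_mul, Submonoid.coe_mul]
  ac_rfl

lemma op_mk_eq {n : ℕ} (φ : V.Op n) {x y : Fin n → R} {s t : S}
    (h : ∀ i, Localization.mk (x i) s = Localization.mk (y i) t) :
    Localization.mk (op φ x) s = Localization.mk (op φ y) t := by
  simp only [Localization.mk_eq_mk_iff, Localization.r_iff_exists] at h ⊢
  choose c hc using h
  refine ⟨∏ i, c i, ?_⟩
  simp only [CMonAlgebra.mul_op]
  congr 1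
  funext i
  rw [← Finset.mul_prod_erase Finset.univ c (Finset.mem_univ i), Submonoid.coe_mul,
    mul_comm (c i : R), mul_assoc, mul_assoc, hc]

/-- The operators on `S⁻¹R`: `φ (x₁ / s, …, xₙ / s) = φ (x₁, …, xₙ) / s`. -/
def locOp {n : ℕ} (φ : V.Op n) (z : Fin n → Localization S) : Localization S :=
  Localization.mk (op φ (exists_common S z).choose) (exists_common S z).choose_spec.choose

lemma locOp_mk {n : ℕ} (φ : V.Op n) (x : Fin n → R) (s : S) :
    locOp S φ (fun i => Localization.mk (x i) s) = Localization.mk (op φ x) s :=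
  (op_mk_eq S φ fun i => (exists_common S
    (fun i => Localization.mk (x i) s)).choose_spec.choose_spec i).symm

lemma eval_mk {n : ℕ} (t : OpTerm V.Op n) (x : Fin n → R) (s : S) :
    t.eval (locOp S) (fun i => Localization.mk (x i) s) = Localization.mk (t.eval op x) s := by
  induction t with
  | var i => rfl
  | app φ t ih =>
    change locOp S φ _ = Localization.mk (op φ _) s
    rw [← locOp_mk]
    exact congrArg _ (funext ih)

instance : V.CMonAlgebra (Localization S) where
  op := locOp S
  eval_eq s t h z := by
    obtain ⟨x, c, hz⟩ := exists_common S z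
    obtain rfl : z = fun i => Localization.mk (x i) c := funext hz
    rw [eval_mk, eval_mk, VAlgebra.eval_eq s t h]
  mul_op a φ z := by
    obtain ⟨x, c, hz⟩ := exists_common S z
    obtain rfl : z = fun i => Localization.mk (x i) c := funext hz
    induction a using Localization.induction_on with
    | H p =>
      simp only [Localization.mk_mul]
      change _ * locOp S φ _ = locOp S φ _
      rw [locOp_mk, locOp_mk, Localization.mk_mul, CMonAlgebra.mul_op]

/-- The localization `S⁻¹R` of a `W`-algebra. -/
def loc : WAlg V := ⟨Localization S⟩

/-- The canonical homomorphism `R → S⁻¹R`. -/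
def toLoc : R ⟶ loc S where
  hom := (Localization.monoidOf S).toMonoidHom
  isHom _ φ x := (locOp_mk S φ x 1).symm

/-- The fraction `x / s` in `S⁻¹R`. -/
def frac (x : R) (s : S) : loc S := Localization.mk x s

lemma exists_frac (z : loc S) : ∃ x s, z = frac S x s := by
  induction z using Localization.induction_on with
  | H p => exact ⟨p.1, p.2, rfl⟩

lemma toLoc_mul_frac (x : R) (s : S) : (toLoc S).hom s * frac S x s = (toLoc S).hom x := by
  change Localization.monoidOf S s * Localization.mk x s = Localization.monoidOf S x
  rw [Localization.mk_eq_monoidOf_mk']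
  exact (Localization.monoidOf S).mk'_spec' _ _

/-- `g : R → A` is a localization at `S`: it makes the elements of `S` invertible, and it is
universal with this property. -/
def IsLoc {A : WAlg V} (g : R ⟶ A) : Prop :=
  (∀ s ∈ S, IsUnit (g.hom s)) ∧
    ∀ (B : WAlg V) (h : R ⟶ B), (∀ s ∈ S, IsUnit (h.hom s)) → ∃! k : A ⟶ B, g ≫ k = h

lemma isLoc_toLoc : IsLoc S (toLoc S) := by
  refine ⟨fun s hs => (Localization.monoidOf S).map_units ⟨s, hs⟩, fun B h hh => ?_⟩
  let k : loc S →* B := (Localization.monoidOf S).lift (g := h.hom) fun s => hh s s.2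
  have hk0 : ∀ x, k ((toLoc S).hom x) = h.hom x := fun x => (Localization.monoidOf S).lift_eq _ _
  have hk : ∀ (k' : loc S →* B), (∀ x, k' ((toLoc S).hom x) = h.hom x) →
      ∀ x (s : S), h.hom s * k' (frac S x s) = h.hom x := fun k' hk' x s => by
    rw [← hk', ← map_mul, toLoc_mul_frac, hk']
  refine ⟨⟨k, fun n φ z => ?_⟩, ?_, fun k' hk' => ?_⟩
  · obtain ⟨x, c, hz⟩ := exists_common S z
    obtain rfl : z = fun i => frac S (x i) c := funext hz
    apply (hh c c.2).mul_left_cancel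
    have h1 : op φ (fun i => frac S (x i) c) = frac S (op φ x) c := locOp_mk S φ x c
    rw [h1, hk k hk0, h.isHom, CMonAlgebra.mul_op]
    exact congrArg _ (funext fun i => (hk k hk0 _ _).symm)
  · ext x
    exact hk0 x
  · ext z
    obtain ⟨x, c, rfl⟩ := exists_frac S z
    apply (hh c c.2).mul_left_cancel
    refine Eq.trans (hk k'.hom (fun x => ?_) x c) (hk k hk0 x c).symm
    rw [← hk']
    rfl

lemma IsLoc.exists_iso {A B : WAlg V} {g : R ⟶ A} {h : R ⟶ B} (hg : IsLoc S g) (hh : IsLoc S h) :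
    ∃ e : A ≅ B, g ≫ e.hom = h := by
  obtain ⟨k, hk, -⟩ := hg.2 B h hh.1
  obtain ⟨l, hl, -⟩ := hh.2 A g hg.1
  refine ⟨⟨k, l, ?_, ?_⟩, hk⟩
  · exact (hg.2 A g hg.1).unique (by rw [← Category.assoc, hk, hl]) (Category.comp_id _)
  · exact (hh.2 B h hh.1).unique (by rw [← Category.assoc, hl, hk]) (Category.comp_id _)

variable {S}

lemma IsLoc.surj {A : WAlg V} {g : R ⟶ A} (hg : IsLoc S g) (y : A) :
    ∃ s ∈ S, ∃ x, g.hom s * y = g.hom x := by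
  obtain ⟨e, he⟩ := (isLoc_toLoc S).exists_iso S hg
  obtain ⟨x, s, hp⟩ := exists_frac S (e.inv.hom y)
  refine ⟨s, s.2, x, ?_⟩
  have hy : y = e.hom.hom (frac S x s) := by
    rw [← hp, ← comp_hom, e.inv_hom_id, id_hom]
  rw [hy, ← he, comp_hom, comp_hom, ← map_mul, toLoc_mul_frac]

lemma IsLoc.eq_iff {A : WAlg V} {g : R ⟶ A} (hg : IsLoc S g) {x y : R} :
    g.hom x = g.hom y ↔ ∃ s ∈ S, s * x = s * y := by
  constructor
  · intro h
    obtain ⟨e, he⟩ := hg.exists_iso S (isLoc_toLoc S)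
    have h2 : (toLoc S).hom x = (toLoc S).hom y := by rw [← he, comp_hom, comp_hom, h]
    obtain ⟨c, hc⟩ := (Localization.monoidOf S).exists_of_eq h2
    exact ⟨c, c.2, hc⟩
  · rintro ⟨s, hs, h⟩
    apply (hg.1 s hs).mul_left_cancel
    rw [← map_mul, ← map_mul, h]

end Localization
/-! ### Ideals -/

/-- An ideal of a `W`-algebra `R`: an `R`-submodule of `R`, that is, a subset closed under the
operators of `V` and under the multiplication by elements of `R`. -/
@[ext]
structure Idl (R : WAlg V) where
  carrier : Set R
  op_mem : ∀ {n : ℕ} (φ : V.Op n) (x : Fin n → R), (∀ i, x i ∈ carrier) → op φ x ∈ carrier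
  mul_mem : ∀ (a x : R), x ∈ carrier → a * x ∈ carrier

/-- Membership in the ideal generated by a set. -/
inductive InSpan {R : WAlg V} (s : Set R) : R → Prop
  | base (x : R) (h : x ∈ s) : InSpan s x
  | op {n : ℕ} (φ : V.Op n) (x : Fin n → R) (h : ∀ i, InSpan s (x i)) : InSpan s (op φ x)
  | mul (a x : R) (h : InSpan s x) : InSpan s (a * x)

namespace Idl

variable {R : WAlg V}

instance : SetLike (Idl R) R := ⟨carrier, fun _ _ => Idl.ext⟩

instance : PartialOrder (Idl R) := .ofSetLike (Idl R) R

/-- The ideal generated by a set. -/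
def span (s : Set R) : Idl R := ⟨{x | InSpan s x}, InSpan.op, InSpan.mul⟩

lemma subset_span (s : Set R) : s ⊆ span s := fun x h => .base x h

lemma span_le {s : Set R} {I : Idl R} : span s ≤ I ↔ s ⊆ I := by
  refine ⟨fun h => (subset_span s).trans h, fun h x hx => ?_⟩
  change InSpan s x at hx
  induction hx with
  | base x hx => exact h hx
  | op φ x _ ih => exact I.op_mem φ x ih
  | mul a x _ ih => exact I.mul_mem a x ih

lemma span_mono {s t : Set R} (h : s ⊆ t) : span s ≤ span t := span_le.mpr (h.trans (subset_span t))

@[simp] lemma span_coe (I : Idl R) : span (I : Set R) = I :=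
  le_antisymm (span_le.mpr fun _ h => h) (subset_span _)

/-- The sum of two ideals: the ideal generated by the union. -/
instance : Add (Idl R) := ⟨fun I J => span (I ∪ J)⟩
/-- The product of two ideals: the ideal generated by the products of elements. -/
instance : Mul (Idl R) := ⟨fun I J => span {z | ∃ x ∈ I, ∃ y ∈ J, x * y = z}⟩
/-- The zero ideal: the ideal generated by the empty set. -/
instance : Zero (Idl R) := ⟨span ∅⟩
/-- The unit ideal. -/
instance : One (Idl R) := ⟨⟨Set.univ, fun _ _ _ => trivial, fun _ _ _ => trivial⟩⟩

lemma mem_one (x : R) : x ∈ (1 : Idl R) := trivial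

lemma le_one (I : Idl R) : I ≤ 1 := fun _ _ => trivial

lemma eq_one_iff {I : Idl R} : I = 1 ↔ (1 : R) ∈ I :=
  ⟨fun h => h ▸ mem_one 1, fun h => le_antisymm (le_one I) fun x _ => by
    simpa using! I.mul_mem x 1 h⟩

lemma span_one : span {(1 : R)} = 1 := eq_one_iff.mpr (subset_span _ rfl)

lemma add_le {I J K : Idl R} : I + J ≤ K ↔ I ≤ K ∧ J ≤ K :=
  span_le.trans Set.union_subset_iff

lemma mul_le {I J K : Idl R} : I * J ≤ K ↔ ∀ x ∈ I, ∀ y ∈ J, x * y ∈ K :=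
  span_le.trans ⟨fun h x hx y hy => h ⟨x, hx, y, hy, rfl⟩, fun h => by
    rintro _ ⟨x, hx, y, hy, rfl⟩; exact h x hx y hy⟩

lemma mul_mem_mul {I J : Idl R} {x y : R} (hx : x ∈ I) (hy : y ∈ J) : x * y ∈ I * J :=
  subset_span _ ⟨x, hx, y, hy, rfl⟩

/-- The ideal of the elements `x` such that `x * y ∈ K`. -/
def colon (K : Idl R) (y : R) : Idl R where
  carrier := {x | x * y ∈ K}
  op_mem φ x h := by
    change op φ x * y ∈ K
    rw [mul_comm, CMonAlgebra.mul_op]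
    exact K.op_mem φ _ fun i => by rw [mul_comm]; exact h i
  mul_mem a x h := by
    change a * x * y ∈ K
    rw [mul_assoc]
    exact K.mul_mem a _ h

lemma span_mul_span (s t : Set R) : span s * span t = span {z | ∃ x ∈ s, ∃ y ∈ t, x * y = z} := by
  set K := span {z | ∃ x ∈ s, ∃ y ∈ t, x * y = z}
  refine le_antisymm (mul_le.mpr fun x hx y hy => ?_) (span_le.mpr ?_)
  · have h1 : ∀ x ∈ s, span t ≤ colon K x := fun x hx => span_le.mpr fun y hy =>
      subset_span _ ⟨x, hx, y, hy, mul_comm _ _⟩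
    have h2 : span s ≤ colon K y := span_le.mpr fun x hx => by
      change x * y ∈ K
      rw [mul_comm]
      exact h1 x hx hy
    exact h2 hx
  · rintro _ ⟨x, hx, y, hy, rfl⟩
    exact mul_mem_mul (subset_span _ hx) (subset_span _ hy)

lemma span_add_span (s t : Set R) : span s + span t = span (s ∪ t) :=
  le_antisymm (add_le.mpr ⟨span_mono Set.subset_union_left, span_mono Set.subset_union_right⟩)
    (span_mono (Set.union_subset_union (subset_span s) (subset_span t)))

lemma left_le_add (I J : Idl R) : I ≤ I + J := (add_le.mp le_rfl).1
lemma right_le_add (I J : Idl R) : J ≤ I + J := (add_le.mp le_rfl).2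

lemma mul_mono {I J K T : Idl R} (h : I ≤ K) (h' : J ≤ T) : I * J ≤ K * T :=
  mul_le.mpr fun _ hx _ hy => mul_mem_mul (h hx) (h' hy)

protected lemma mul_comm (I J : Idl R) : I * J = J * I :=
  le_antisymm (mul_le.mpr fun x hx y hy => mul_comm y x ▸ mul_mem_mul hy hx)
    (mul_le.mpr fun x hx y hy => mul_comm y x ▸ mul_mem_mul hy hx)

lemma mul_le_right (I J : Idl R) : I * J ≤ J := mul_le.mpr fun x _ y hy => J.mul_mem x y hy
lemma mul_le_left (I J : Idl R) : I * J ≤ I := Idl.mul_comm I J ▸ mul_le_right J I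

/-- The semiring of ideals. -/
instance : CommSemiring (Idl R) where
  add_assoc I J K := le_antisymm
    (add_le.mpr ⟨add_le.mpr ⟨left_le_add _ _, (left_le_add _ _).trans (right_le_add _ _)⟩,
      (right_le_add _ _).trans (right_le_add _ _)⟩)
    (add_le.mpr ⟨(left_le_add _ _).trans (left_le_add _ _),
      add_le.mpr ⟨(right_le_add _ _).trans (left_le_add _ _), right_le_add _ _⟩⟩)
  zero_add I := le_antisymm (add_le.mpr ⟨span_le.mpr (Set.empty_subset _), le_rfl⟩)
    (right_le_add _ _)
  add_zero I := le_antisymm (add_le.mpr ⟨le_rfl, span_le.mpr (Set.empty_subset _)⟩)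
    (left_le_add _ _)
  add_comm I J := le_antisymm (add_le.mpr ⟨right_le_add _ _, left_le_add _ _⟩)
    (add_le.mpr ⟨right_le_add _ _, left_le_add _ _⟩)
  nsmul := nsmulRec
  left_distrib I J K := by
    refine le_antisymm ?_ (add_le.mpr ⟨mul_mono le_rfl (left_le_add _ _),
      mul_mono le_rfl (right_le_add _ _)⟩)
    conv_lhs => rw [← span_coe I, ← span_coe J, ← span_coe K, span_add_span, span_mul_span]
    refine span_le.mpr ?_
    rintro _ ⟨x, hx, y, hy | hy, rfl⟩
    · exact left_le_add _ _ (mul_mem_mul hx hy)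
    · exact right_le_add _ _ (mul_mem_mul hx hy)
  right_distrib I J K := by
    refine le_antisymm ?_ (add_le.mpr ⟨mul_mono (left_le_add _ _) le_rfl,
      mul_mono (right_le_add _ _) le_rfl⟩)
    conv_lhs => rw [← span_coe I, ← span_coe J, ← span_coe K, span_add_span, span_mul_span]
    refine span_le.mpr ?_
    rintro _ ⟨x, hx | hx, y, hy, rfl⟩
    · exact left_le_add _ _ (mul_mem_mul hx hy)
    · exact right_le_add _ _ (mul_mem_mul hx hy)
  zero_mul I := le_antisymm (mul_le_left _ _) (span_le.mpr (Set.empty_subset _))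
  mul_zero I := le_antisymm (mul_le_right _ _) (span_le.mpr (Set.empty_subset _))
  mul_assoc I J K := by
    rw [← span_coe I, ← span_coe J, ← span_coe K]
    simp only [span_mul_span]
    congr 1
    ext z
    constructor
    · rintro ⟨_, ⟨x, hx, y, hy, rfl⟩, w, hw, rfl⟩
      exact ⟨x, hx, _, ⟨y, hy, w, hw, rfl⟩, (mul_assoc _ _ _).symm⟩
    · rintro ⟨x, hx, _, ⟨y, hy, w, hw, rfl⟩, rfl⟩
      exact ⟨_, ⟨x, hx, y, hy, rfl⟩, w, hw, mul_assoc _ _ _⟩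
  one_mul I := le_antisymm (mul_le_right _ _) fun x hx => by
    simpa using! mul_mem_mul (mem_one (1 : R)) hx
  mul_one I := le_antisymm (mul_le_left _ _) fun x hx => by
    simpa using! mul_mem_mul hx (mem_one (1 : R))
  mul_comm := Idl.mul_comm

lemma pow_mono {I J : Idl R} (h : I ≤ J) (n : ℕ) : I ^ n ≤ J ^ n := by
  induction n with
  | zero => simp
  | succ n ih => rw [pow_succ, pow_succ]; exact mul_mono ih h

lemma pow_anti (I : Idl R) {m n : ℕ} (h : m ≤ n) : I ^ n ≤ I ^ m := by
  obtain ⟨k, rfl⟩ := Nat.exists_eq_add_of_le h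
  rw [pow_add]; exact mul_le_left _ _

lemma pow_add_le {I J K : Idl R} {m n : ℕ} (h : I ^ m ≤ K) (h' : J ^ n ≤ K) :
    (I + J) ^ (m + n) ≤ K := by
  have hs : ∀ (t : Finset ℕ) (f : ℕ → Idl R), (∀ i ∈ t, f i ≤ K) → ∑ i ∈ t, f i ≤ K := by
    intro t f
    induction t using Finset.cons_induction with
    | empty => exact fun _ => span_le.mpr (Set.empty_subset _)
    | cons a t ha ih =>
      intro h
      rw [Finset.sum_cons]
      exact add_le.mpr ⟨h a (Finset.mem_cons_self a t), ih fun i hi =>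
        h i (Finset.mem_cons_of_mem hi)⟩
  rw [add_pow]
  refine hs _ _ fun i _ => (mul_le_left _ _).trans ?_
  rcases le_total m i with hi | hi
  · exact (mul_le_left _ _).trans ((pow_anti I hi).trans h)
  · exact (mul_le_right _ _).trans ((pow_anti J (by omega)).trans h')

/-- Finitely generated ideals. -/
def FG (I : Idl R) : Prop := ∃ s : Set R, s.Finite ∧ span s = I

lemma FG.add {I J : Idl R} : I.FG → J.FG → (I + J).FG := by
  rintro ⟨s, hs, rfl⟩ ⟨t, ht, rfl⟩
  exact ⟨s ∪ t, hs.union ht, (span_add_span s t).symm⟩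

lemma FG.mul {I J : Idl R} : I.FG → J.FG → (I * J).FG := by
  rintro ⟨s, hs, rfl⟩ ⟨t, ht, rfl⟩
  exact ⟨_, Set.Finite.image2 (· * ·) hs ht, (span_mul_span s t).symm⟩

lemma pow_span_le {s : Set R} (hs : s.Finite) {J : Idl R} (h : ∀ x ∈ s, ∃ n : ℕ, x ^ n ∈ J) :
    ∃ n, span s ^ n ≤ J := by
  induction s, hs using Set.Finite.induction_on with
  | empty => exact ⟨1, by rw [pow_one]; exact span_le.mpr (Set.empty_subset _)⟩
  | @insert a s _ _ ih =>
    obtain ⟨n, hn⟩ := ih fun x hx => h x (Set.mem_insert_of_mem a hx)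
    obtain ⟨m, hm⟩ := h a (Set.mem_insert a s)
    refine ⟨m + n, ?_⟩
    rw [Set.insert_eq, ← span_add_span]
    refine pow_add_le ?_ hn
    have : ∀ k : ℕ, span {a} ^ k = span {a ^ k} := fun k => by
      induction k with
      | zero => rw [pow_zero, pow_zero, span_one]
      | succ k ih => rw [pow_succ, pow_succ, ih, span_mul_span]; congr 1; ext; simp [eq_comm]
    rw [this]
    exact span_le.mpr (by simpa using hm)

/-- The ideal of `S` generated by the image of an ideal of `R`. -/
def map {R S : WAlg V} (f : R ⟶ S) (I : Idl R) : Idl S := span (f.hom '' I)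

/-- The inverse image of an ideal. -/
def comap {R S : WAlg V} (f : R ⟶ S) (J : Idl S) : Idl R where
  carrier := {x | f.hom x ∈ J}
  op_mem φ x h := by
    change f.hom (op φ x) ∈ J
    rw [f.isHom]; exact J.op_mem φ _ h
  mul_mem a x h := by
    change f.hom (a * x) ∈ J
    rw [map_mul]; exact J.mul_mem _ _ h

lemma map_span {R S : WAlg V} (f : R ⟶ S) (s : Set R) : map f (span s) = span (f.hom '' s) := by
  refine le_antisymm (span_le.mpr ?_) (span_mono (Set.image_mono (subset_span s)))
  rintro _ ⟨x, hx, rfl⟩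
  exact (span_le (I := comap f (span (f.hom '' s)))).mpr
    (fun x hx => subset_span _ ⟨x, hx, rfl⟩) hx

section
variable {R S : WAlg V} (f : R ⟶ S)

lemma map_mono {I J : Idl R} (h : I ≤ J) : map f I ≤ map f J := span_mono (Set.image_mono h)

lemma map_add (I J : Idl R) : map f (I + J) = map f I + map f J := by
  conv_lhs => rw [← span_coe I, ← span_coe J, span_add_span, map_span, Set.image_union]
  rw [map, map, span_add_span]

lemma map_mul' (I J : Idl R) : map f (I * J) = map f I * map f J := by
  conv_lhs => rw [← span_coe I, ← span_coe J, span_mul_span, map_span]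
  rw [map, map, span_mul_span]
  congr 1
  ext z
  constructor
  · rintro ⟨_, ⟨x, hx, y, hy, rfl⟩, rfl⟩
    exact ⟨_, ⟨x, hx, rfl⟩, _, ⟨y, hy, rfl⟩, (map_mul _ _ _).symm⟩
  · rintro ⟨_, ⟨x, hx, rfl⟩, _, ⟨y, hy, rfl⟩, rfl⟩
    exact ⟨_, ⟨x, hx, y, hy, rfl⟩, map_mul _ _ _⟩

lemma map_one' : map f (1 : Idl R) = 1 := by
  rw [← span_one, map_span, Set.image_singleton, map_one, span_one]

lemma map_pow' (I : Idl R) (n : ℕ) : map f (I ^ n) = map f I ^ n := by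
  induction n with
  | zero => simp [map_one']
  | succ n ih => rw [pow_succ, pow_succ, map_mul', ih]

lemma map_zero' : map f (0 : Idl R) = 0 :=
  (map_span f ∅).trans (by rw [Set.image_empty]; rfl)

lemma map_comp {T : WAlg V} (g : S ⟶ T) (I : Idl R) : map (f ≫ g) I = map g (map f I) := by
  conv_rhs => rw [map, map, ← map, map_span, ← Set.image_comp]
  rfl

lemma FG.map {I : Idl R} : I.FG → (map f I).FG := by
  rintro ⟨s, hs, rfl⟩
  exact ⟨_, hs.image _, (map_span f s).symm⟩

end

end Idl
/-! ### The lattice of finitely generated ideals modulo radical equivalence -/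

/-- Radical equivalence of finitely generated ideals: `𝔞ⁿ ≤ 𝔟` and `𝔟ⁿ ≤ 𝔞` for `n ≫ 0`. -/
def radSetoid (R : WAlg V) : Setoid {I : Idl R // I.FG} where
  r I J := ∀ᶠ n : ℕ in Filter.atTop, I.1 ^ n ≤ J.1 ∧ J.1 ^ n ≤ I.1
  iseqv :=
    { refl := fun I => Filter.eventually_atTop.mpr ⟨1, fun n hn => by
        have := Idl.pow_anti I.1 hn
        rw [pow_one] at this
        exact ⟨this, this⟩⟩
      symm := fun h => h.mono fun _ hn => hn.symm
      trans := fun {I J K} h h' => by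
        obtain ⟨m, hm⟩ := h.exists
        obtain ⟨k, hk⟩ := h'.exists
        refine Filter.eventually_atTop.mpr ⟨m * k, fun n hn => ⟨?_, ?_⟩⟩
        · refine (Idl.pow_anti _ hn).trans ?_
          rw [pow_mul]
          exact (Idl.pow_mono hm.1 k).trans hk.1
        · refine (Idl.pow_anti _ hn).trans ?_
          rw [mul_comm, pow_mul]
          exact (Idl.pow_mono hk.2 m).trans hm.2 }

/-- The set `α₁(R)` of finitely generated ideals of `R` modulo radical equivalence. -/
def RadIdl (R : WAlg V) : Type u := Quotient (radSetoid R)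

namespace RadIdl

variable {R : WAlg V}

/-- The class of a finitely generated ideal. -/
def mk (I : Idl R) (h : I.FG) : RadIdl R := Quotient.mk _ ⟨I, h⟩

lemma ind {p : RadIdl R → Prop} (h : ∀ I hI, p (mk I hI)) (x : RadIdl R) : p x :=
  Quotient.ind (fun I => h I.1 I.2) x

lemma mk_eq_iff {I J : Idl R} {hI : I.FG} {hJ : J.FG} :
    mk I hI = mk J hJ ↔ (∃ n, I ^ n ≤ J) ∧ ∃ n, J ^ n ≤ I := by
  refine Quotient.eq.trans ⟨fun h => ?_, fun ⟨⟨m, hm⟩, ⟨k, hk⟩⟩ => ?_⟩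
  · obtain ⟨n, h1, h2⟩ := Filter.Eventually.exists h
    exact ⟨⟨n, h1⟩, ⟨n, h2⟩⟩
  · exact Filter.eventually_atTop.mpr ⟨m + k, fun n hn =>
      ⟨(Idl.pow_anti _ (by omega)).trans hm, (Idl.pow_anti _ (by omega)).trans hk⟩⟩

/-- The join, induced by the sum of ideals. -/
instance : Max (RadIdl R) := ⟨Quotient.map₂ (fun I J => ⟨I.1 + J.1, I.2.add J.2⟩) (by
  intro I I' h J J' h'
  have h := mk_eq_iff.mp (Quotient.sound h)
  have h' := mk_eq_iff.mp (Quotient.sound h')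
  obtain ⟨⟨m, hm⟩, ⟨n, hn⟩⟩ := h
  obtain ⟨⟨k, hk⟩, ⟨l, hl⟩⟩ := h'
  exact Quotient.exact (mk_eq_iff.mpr
    ⟨⟨_, Idl.pow_add_le (hm.trans (Idl.left_le_add _ _)) (hk.trans (Idl.right_le_add _ _))⟩,
      ⟨_, Idl.pow_add_le (hn.trans (Idl.left_le_add _ _)) (hl.trans (Idl.right_le_add _ _))⟩⟩))⟩

/-- The meet, induced by the product of ideals. -/
instance : Min (RadIdl R) := ⟨Quotient.map₂ (fun I J => ⟨I.1 * J.1, I.2.mul J.2⟩) (by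
  intro I I' h J J' h'
  have h := mk_eq_iff.mp (Quotient.sound h)
  have h' := mk_eq_iff.mp (Quotient.sound h')
  obtain ⟨⟨m, hm⟩, ⟨n, hn⟩⟩ := h
  obtain ⟨⟨k, hk⟩, ⟨l, hl⟩⟩ := h'
  refine Quotient.exact (mk_eq_iff.mpr ⟨⟨m + k, ?_⟩, ⟨n + l, ?_⟩⟩)
  · rw [mul_pow]
    exact Idl.mul_mono ((Idl.pow_anti _ (by omega)).trans hm)
      ((Idl.pow_anti _ (by omega)).trans hk)
  · rw [mul_pow]
    exact Idl.mul_mono ((Idl.pow_anti _ (by omega)).trans hn)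
      ((Idl.pow_anti _ (by omega)).trans hl))⟩

lemma mk_sup {I J : Idl R} (hI : I.FG) (hJ : J.FG) :
    mk I hI ⊔ mk J hJ = mk (I + J) (hI.add hJ) := rfl

lemma mk_inf {I J : Idl R} (hI : I.FG) (hJ : J.FG) :
    mk I hI ⊓ mk J hJ = mk (I * J) (hI.mul hJ) := rfl

lemma sup_eq_iff {I J : Idl R} {hI : I.FG} {hJ : J.FG} :
    mk I hI ⊔ mk J hJ = mk J hJ ↔ ∃ n, I ^ n ≤ J := by
  refine mk_eq_iff.trans ⟨fun ⟨⟨n, h⟩, _⟩ => ⟨n, (Idl.pow_mono (Idl.left_le_add I J) n).trans h⟩,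
    fun ⟨n, h⟩ => ⟨⟨n + 1, Idl.pow_add_le h (by rw [pow_one])⟩, ⟨1, ?_⟩⟩⟩
  rw [pow_one]; exact Idl.right_le_add _ _

instance : PartialOrder (RadIdl R) where
  le x y := x ⊔ y = y
  le_refl := ind fun I hI => sup_eq_iff.mpr ⟨1, by rw [pow_one]⟩
  le_trans := ind fun I hI => ind fun J hJ => ind fun K hK h h' => by
    obtain ⟨m, hm⟩ := sup_eq_iff.mp h
    obtain ⟨n, hn⟩ := sup_eq_iff.mp h'
    exact sup_eq_iff.mpr ⟨m * n, by rw [pow_mul]; exact (Idl.pow_mono hm n).trans hn⟩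
  le_antisymm := ind fun I hI => ind fun J hJ h h' =>
    mk_eq_iff.mpr ⟨sup_eq_iff.mp h, sup_eq_iff.mp h'⟩

lemma mk_le_iff {I J : Idl R} {hI : I.FG} {hJ : J.FG} :
    mk I hI ≤ mk J hJ ↔ ∃ n, I ^ n ≤ J := sup_eq_iff

instance : Lattice (RadIdl R) where
  sup x y := x ⊔ y
  inf x y := x ⊓ y
  le_sup_left := ind fun I hI => ind fun J hJ => mk_le_iff.mpr ⟨1, by
    rw [pow_one]; exact Idl.left_le_add _ _⟩
  le_sup_right := ind fun I hI => ind fun J hJ => mk_le_iff.mpr ⟨1, by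
    rw [pow_one]; exact Idl.right_le_add _ _⟩
  sup_le := ind fun I hI => ind fun J hJ => ind fun K hK h h' => by
    obtain ⟨m, hm⟩ := mk_le_iff.mp h
    obtain ⟨n, hn⟩ := mk_le_iff.mp h'
    exact mk_le_iff.mpr ⟨_, Idl.pow_add_le hm hn⟩
  inf_le_left := ind fun I hI => ind fun J hJ => mk_le_iff.mpr ⟨1, by
    rw [pow_one]; exact Idl.mul_le_left _ _⟩
  inf_le_right := ind fun I hI => ind fun J hJ => mk_le_iff.mpr ⟨1, by
    rw [pow_one]; exact Idl.mul_le_right _ _⟩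
  le_inf := ind fun I hI => ind fun J hJ => ind fun K hK h h' => by
    obtain ⟨m, hm⟩ := mk_le_iff.mp h
    obtain ⟨n, hn⟩ := mk_le_iff.mp h'
    exact mk_le_iff.mpr ⟨m + n, by rw [pow_add]; exact Idl.mul_mono hm hn⟩

instance : DistribLattice (RadIdl R) :=
  DistribLattice.ofInfSupLe <| ind fun I hI => ind fun J hJ => ind fun K hK =>
    mk_le_iff.mpr ⟨1, by rw [pow_one, mul_add]⟩

lemma fg_zero : (0 : Idl R).FG := ⟨∅, Set.finite_empty, rfl⟩
lemma fg_principal (a : R) : (Idl.span {a}).FG := ⟨{a}, Set.finite_singleton a, rfl⟩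
lemma fg_one : (1 : Idl R).FG := ⟨{1}, Set.finite_singleton 1, Idl.span_one⟩

instance : BoundedOrder (RadIdl R) where
  top := mk 1 fg_one
  bot := mk 0 fg_zero
  le_top := ind fun I hI => mk_le_iff.mpr ⟨1, Idl.le_one _⟩
  bot_le := ind fun I hI => mk_le_iff.mpr ⟨1, by
    rw [pow_one]; exact Idl.span_le.mpr (Set.empty_subset _)⟩

/-- The class of the principal ideal generated by an element. -/
def principal (a : R) : RadIdl R := mk (Idl.span {a}) (fg_principal a)

lemma principal_mul (a b : R) : principal (a * b) = principal a ⊓ principal b := by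
  change mk _ _ = mk (Idl.span {a} * Idl.span {b}) _
  congr 1
  rw [Idl.span_mul_span]
  congr 1
  ext; simp [eq_comm]

lemma principal_one : principal (1 : R) = ⊤ := by
  change mk _ _ = mk _ _
  congr 1
  exact Idl.span_one

/-- The homomorphism of lattices induced by a homomorphism of `W`-algebras. -/
def map {S : WAlg V} (f : R ⟶ S) : BoundedLatticeHom (RadIdl R) (RadIdl S) where
  toFun := Quotient.map (fun I => ⟨Idl.map f I.1, Idl.FG.map f I.2⟩) (by
    intro I J h
    obtain ⟨⟨m, hm⟩, ⟨n, hn⟩⟩ := mk_eq_iff.mp (Quotient.sound h)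
    refine Quotient.exact (mk_eq_iff.mpr ⟨⟨m, ?_⟩, ⟨n, ?_⟩⟩)
    · rw [← Idl.map_pow']; exact Idl.map_mono f hm
    · rw [← Idl.map_pow']; exact Idl.map_mono f hn)
  map_sup' := ind fun I hI => ind fun J hJ => by
    change mk _ _ = mk _ _
    congr 1; exact Idl.map_add f I J
  map_inf' := ind fun I hI => ind fun J hJ => by
    change mk _ _ = mk _ _
    congr 1; exact Idl.map_mul' f I J
  map_top' := by
    change mk _ _ = mk _ _
    congr 1; exact Idl.map_one' f
  map_bot' := by
    change mk _ _ = mk _ _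
    congr 1; exact Idl.map_zero' f

lemma map_mk {S : WAlg V} (f : R ⟶ S) (I : Idl R) (hI : I.FG) :
    map f (mk I hI) = mk (Idl.map f I) (Idl.FG.map f hI) := rfl

lemma map_principal {S : WAlg V} (f : R ⟶ S) (a : R) :
    map f (principal a) = principal (f.hom a) := by
  rw [principal, map_mk, principal]
  congr 1
  rw [Idl.map_span, Set.image_singleton]

end RadIdl

variable (V) in
/-- The functor `α₁` from `W`-algebras to distributive lattices. -/
def radFunctor : WAlg V ⥤ BddDistLat.{u} where
  obj R := BddDistLat.of (RadIdl R)
  map f := BddDistLat.ofHom (RadIdl.map f)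
  map_id R := by
    ext x
    induction x using RadIdl.ind with
    | h I hI =>
      change RadIdl.mk _ _ = RadIdl.mk _ _
      congr 1
      rw [Idl.map]
      exact (congrArg Idl.span (Set.image_id (I : Set R))).trans (Idl.span_coe I)
  map_comp f g := by
    ext x
    induction x using RadIdl.ind with
    | h I hI =>
      change RadIdl.mk _ _ = RadIdl.mk _ _
      congr 1
      exact Idl.map_comp f g I
/-! ### Schematizable algebraic types and `𝒜`-schemes -/

section
variable {R A : WAlg V} {S : Submonoid R} {g : R ⟶ A}

lemma IsLoc.mem_map (hg : IsLoc S g) (J : Idl R) {y : A} (hy : y ∈ Idl.map g J) :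
    ∃ s ∈ S, ∃ x ∈ J, g.hom s * y = g.hom x := by
  change InSpan _ y at hy
  induction hy with
  | base y h =>
    obtain ⟨x, hx, rfl⟩ := h
    exact ⟨1, S.one_mem, x, hx, by rw [map_one, one_mul]⟩
  | @op n φ y _ ih =>
    choose s hs x hx h using ih
    refine ⟨∏ i, s i, S.prod_mem fun i _ => hs i,
      op φ fun i => (∏ j ∈ Finset.univ.erase i, s j) * x i,
      J.op_mem φ _ fun i => J.mul_mem _ _ (hx i), ?_⟩
    rw [CMonAlgebra.mul_op, g.isHom]
    congr 1
    funext i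
    rw [map_mul, ← h, ← Finset.mul_prod_erase Finset.univ s (Finset.mem_univ i), map_mul]
    ac_rfl
  | mul a y _ ih =>
    obtain ⟨s, hs, x, hx, h⟩ := ih
    obtain ⟨t, ht, b, hb⟩ := hg.surj a
    refine ⟨t * s, S.mul_mem ht hs, b * x, J.mul_mem _ _ hx, ?_⟩
    rw [map_mul, map_mul, ← h, ← hb]
    ac_rfl

lemma IsLoc.of_mem_map (hg : IsLoc S g) (J : Idl R) {x : R} (hx : g.hom x ∈ Idl.map g J) :
    ∃ s ∈ S, s * x ∈ J := by
  obtain ⟨s, hs, y, hy, h⟩ := hg.mem_map J hx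
  rw [← map_mul, hg.eq_iff] at h
  obtain ⟨t, ht, h⟩ := h
  exact ⟨t * s, S.mul_mem ht hs, by rw [mul_assoc, h]; exact J.mul_mem _ _ hy⟩

lemma IsLoc.le_of_map_le (hg : IsLoc S g) {I J : Idl R} (hI : I.FG)
    (h : Idl.map g I ≤ Idl.map g J) : ∃ s ∈ S, I * Idl.span {s} ≤ J := by
  obtain ⟨T, hT, rfl⟩ := hI
  induction T, hT using Set.Finite.induction_on with
  | empty => exact ⟨1, S.one_mem, (Idl.mul_le_left _ _).trans
      (Idl.span_le.mpr (Set.empty_subset _))⟩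
  | @insert a T _ _ ih =>
    obtain ⟨s, hs, h1⟩ := ih ((Idl.map_mono g (Idl.span_mono (Set.subset_insert a T))).trans h)
    obtain ⟨t, ht, h2⟩ := hg.of_mem_map J (x := a)
      (h (Idl.subset_span _ ⟨a, Idl.subset_span _ (Set.mem_insert a T), rfl⟩))
    refine ⟨s * t, S.mul_mem hs ht, ?_⟩
    rw [Set.insert_eq, ← Idl.span_add_span, add_mul]
    refine Idl.add_le.mpr ⟨?_, (Idl.mul_mono le_rfl ?_).trans h1⟩
    · rw [Idl.span_mul_span]
      refine Idl.span_le.mpr ?_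
      rintro _ ⟨_, rfl, _, rfl, rfl⟩
      rw [mul_left_comm, mul_comm _ t]
      exact J.mul_mem _ _ h2
    · refine Idl.span_le.mpr ?_
      rintro _ rfl
      change s * t ∈ Idl.span {s}
      rw [mul_comm]
      exact (Idl.span {s}).mul_mem _ _ (Idl.subset_span _ rfl)

lemma RadIdl.map_surjective (hg : IsLoc S g) : Function.Surjective (RadIdl.map g) := by
  refine RadIdl.ind ?_
  rintro _ ⟨T, hT, rfl⟩
  choose s hs x hx using hg.surj
  have hF : (Idl.span (x '' T)).FG := ⟨_, hT.image x, rfl⟩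
  refine ⟨RadIdl.mk (Idl.span (x '' T)) hF, ?_⟩
  rw [RadIdl.map_mk]
  congr 1
  rw [Idl.map_span, ← Set.image_comp]
  refine le_antisymm (Idl.span_le.mpr ?_) (Idl.span_le.mpr fun y hy => ?_)
  · rintro _ ⟨y, hy, rfl⟩
    change g.hom (x y) ∈ _
    rw [← hx]
    exact (Idl.span T).mul_mem _ _ (Idl.subset_span _ hy)
  · obtain ⟨c, hc⟩ := (hg.1 _ (hs y)).exists_left_inv
    have : y = c * g.hom (x y) := by rw [← hx, ← mul_assoc, hc, one_mul]
    rw [this]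
    exact Idl.mul_mem _ _ _ (Idl.subset_span _ ⟨y, hy, rfl⟩)

lemma RadIdl.map_le_iff (hg : IsLoc S g) (a b : RadIdl R) :
    RadIdl.map g a ≤ RadIdl.map g b ↔ ∃ s ∈ S, a ⊓ RadIdl.principal s ≤ b := by
  induction a using RadIdl.ind with
  | h I hI =>
  induction b using RadIdl.ind with
  | h J hJ =>
  rw [RadIdl.map_mk, RadIdl.map_mk, RadIdl.mk_le_iff]
  constructor
  · rintro ⟨n, h⟩
    rw [← Idl.map_pow'] at h
    have hn : ∀ n, (I ^ n).FG := fun n => by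
      induction n with
      | zero => rw [pow_zero]; exact RadIdl.fg_one
      | succ n ih => rw [pow_succ]; exact ih.mul hI
    obtain ⟨s, hs, h⟩ := hg.le_of_map_le (hn n) h
    refine ⟨s, hs, RadIdl.mk_le_iff (hI := hI.mul (RadIdl.fg_principal s)).mpr ⟨n + 1, ?_⟩⟩
    rw [mul_pow]
    refine (Idl.mul_mono (Idl.pow_anti I (Nat.le_succ n)) ?_).trans h
    refine (Idl.pow_anti _ (Nat.succ_le_succ (Nat.zero_le n))).trans ?_
    rw [pow_one]
  · rintro ⟨s, hs, h⟩
    obtain ⟨n, h⟩ := RadIdl.mk_le_iff (hI := hI.mul (RadIdl.fg_principal s)).mp h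
    refine ⟨n, ?_⟩
    have h := Idl.map_mono g h
    rw [Idl.map_pow', Idl.map_mul', Idl.map_span, Set.image_singleton] at h
    have h1 : Idl.span {g.hom s} = 1 := by
      rw [Idl.eq_one_iff]
      obtain ⟨c, hc⟩ := (hg.1 s hs).exists_left_inv
      rw [← hc]
      exact Idl.mul_mem _ _ _ (Idl.subset_span _ rfl)
    rwa [h1, mul_one] at h

end

variable (V) in
/-- A schematizable algebraic type `(W, α₁, α₂, γ)`, where `W` is the type of commutative monoid
objects in `V`-algebras. The datum `γ` is a natural isomorphism, under `α₁(R)`, between `α₁(S⁻¹R)`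
and the localization of `α₁(R)` at `α₂(S)`; the latter is the quotient of `α₁(R)` in which `a` and
`b` are identified when `a ⊓ α₂(s) = b ⊓ α₂(s)` for some `s ∈ S`, so that there is at most one such
isomorphism, and it exists if and only if `α₁(R) → α₁(S⁻¹R)` is surjective and makes exactly these
identifications. -/
structure SchematizableType where
  α₁ : WAlg V ⥤ BddDistLat.{u}
  α₂ : ∀ R : WAlg V, R → α₁.obj R
  α₂_naturality : ∀ {R S : WAlg V} (f : R ⟶ S) (a : R), α₂ S (f.hom a) = α₁.map f (α₂ R a)
  α₂_one : ∀ R : WAlg V, α₂ R 1 = ⊤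
  α₂_mul : ∀ (R : WAlg V) (a b : R), α₂ R (a * b) = α₂ R a ⊓ α₂ R b
  γ_surjective : ∀ (R : WAlg V) (S : Submonoid R), Function.Surjective (α₁.map (toLoc S))
  γ_eq_iff : ∀ (R : WAlg V) (S : Submonoid R) (a b : α₁.obj R),
    α₁.map (toLoc S) a = α₁.map (toLoc S) b ↔ ∃ s ∈ S, a ⊓ α₂ R s = b ⊓ α₂ R s

variable (V) in
/-- The schematizable algebraic type attached to `V`: the lattice `α₁(R)` consists of the finitely
generated ideals of `R` modulo radical equivalence, and `α₂` sends an element to the principal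
ideal that it generates. -/
def idealType : SchematizableType V where
  α₁ := radFunctor V
  α₂ _ a := RadIdl.principal a
  α₂_naturality f a := (RadIdl.map_principal f a).symm
  α₂_one _ := RadIdl.principal_one
  α₂_mul _ := RadIdl.principal_mul
  γ_surjective _ S := RadIdl.map_surjective (isLoc_toLoc S)
  γ_eq_iff R S a b := by
    change RadIdl.map (toLoc S) a = RadIdl.map (toLoc S) b ↔
      ∃ s ∈ S, (a ⊓ RadIdl.principal s : RadIdl R) = b ⊓ RadIdl.principal s
    have h := RadIdl.map_le_iff (isLoc_toLoc S)
    constructor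
    · intro h1
      obtain ⟨s, hs, h2⟩ := (h a b).mp h1.le
      obtain ⟨t, ht, h3⟩ := (h b a).mp h1.ge
      refine ⟨s * t, S.mul_mem hs ht, ?_⟩
      rw [RadIdl.principal_mul]
      refine le_antisymm (le_inf ?_ inf_le_right) (le_inf ?_ inf_le_right)
      · exact (inf_le_inf_left a inf_le_left).trans h2
      · exact (inf_le_inf_left b inf_le_right).trans h3
    · rintro ⟨s, hs, h1⟩
      exact le_antisymm ((h a b).mpr ⟨s, hs, h1.le.trans inf_le_left⟩)
        ((h b a).mpr ⟨s, hs, h1.ge.trans inf_le_left⟩)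

end WAlg

namespace Coh

variable {D : Type (u + 1)} [Category.{u} D] {L : D ⥤ BddDistLat.{u}}

lemma SupportedSpace.support_top (X : SupportedSpace L) (U : CompactOpens X.carrier) :
    X.support (U := U) ⊤ = U := by
  have h : (X.β.hom.app (op U)) ((toLatticeSheaf L X.O).app (op U) ⊤) = ⊤ :=
    (congrArg _ (map_top ((toLatticeSheaf L X.O).app (op U)).hom)).trans
      (map_top (X.β.hom.app (op U)).hom)
  exact congrArg Subtype.val h

lemma SupportedSpace.support_inf (X : SupportedSpace L) {U : CompactOpens X.carrier}
    (a b : L.obj (X.O.obj.obj (op U))) : X.support (a ⊓ b) = X.support a ⊓ X.support b := by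
  have h := (congrArg (X.β.hom.app (op U))
    (((toLatticeSheaf L X.O).app (op U)).hom.map_inf' a b)).trans
      ((X.β.hom.app (op U)).hom.map_inf' _ _)
  exact congrArg Subtype.val h

end Coh

open Coh

namespace WAlg

variable {V : AlgType.{u}} (𝒜 : SchematizableType V)

/-- For quasi-compact open subsets `T ⊆ U`, the multiplicative system of the elements `f` of
`O_X(U)` with `β_X(α₂(f)) ≥ T`. -/
def supportSystem (X : SupportedSpace 𝒜.α₁) {T U : CompactOpens X.carrier} (h : T ≤ U) :
    Submonoid (X.O.obj.obj (op U)) where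
  carrier := {f | T ≤ X.support (U := U) (𝒜.α₂ _ f)}
  one_mem' := by
    change T ≤ X.support _
    rw [𝒜.α₂_one, X.support_top]
    exact h
  mul_mem' {a b} ha hb := by
    change T ≤ X.support _
    rw [𝒜.α₂_mul, X.support_inf]
    exact le_inf ha hb

/-- The restriction maps reflect localizations: for quasi-compact open subsets `T ⊆ U`, the
restriction map `O_X(U) → O_X(T)` factors through the localization `O_X(U)_T` of `O_X(U)` by the
multiplicative system of the elements `f` with `β_X(α₂(f)) ≥ T`. -/
def IsAScheme : ObjectProperty (SupportedSpace 𝒜.α₁) := fun X =>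
  ∀ (T U : CompactOpens X.carrier) (h : T ≤ U),
    ∃ k : loc (supportSystem 𝒜 X h) ⟶ X.O.obj.obj (op T),
      toLoc (supportSystem 𝒜 X h) ≫ k = X.O.obj.map (homOfLE h).op

/-- The category of `𝒜`-schemes. -/
abbrev AScheme : Type (u + 1) := (IsAScheme 𝒜).FullSubcategory

end WAlg
/-! ### Coherent Grothendieck topologies and the lattice `Ω₁` -/
namespace CohSite

variable {C : Type (u + 1)} [Category.{u} C]

/-- An `ℰ`-morphism with target `X`. -/
structure EOver (E : MorphismProperty C) (X : C) where
  left : C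
  hom : left ⟶ X
  prop : E hom

namespace EOver

variable {E : MorphismProperty C}

/-- `h` factors through the `ℰ`-morphism `V → X`. -/
def Fac {A X : C} (h : A ⟶ X) (V : EOver E X) : Prop := ∃ m : A ⟶ V.left, m ≫ V.hom = h

lemma fac_self {X : C} (V : EOver E X) : Fac V.hom V := ⟨𝟙 _, Category.id_comp _⟩

lemma Fac.comp {A B X : C} {h : A ⟶ X} {V : EOver E X} (H : Fac h V) (k : B ⟶ A) :
    Fac (k ≫ h) V := by
  obtain ⟨m, rfl⟩ := H
  exact ⟨k ≫ m, Category.assoc _ _ _⟩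

/-- The `ℰ`-morphism `id : X → X`. -/
def refl [E.ContainsIdentities] (X : C) : EOver E X := ⟨X, 𝟙 X, E.id_mem X⟩

lemma fac_refl [E.ContainsIdentities] {A X : C} (h : A ⟶ X) : Fac h (refl (E := E) X) :=
  ⟨h, Category.comp_id h⟩

variable [E.IsStableUnderBaseChange] [E.HasPullbacks]

/-- The base change `X ×_Y U → X` of an `ℰ`-morphism `U → Y` along `f : X → Y`. -/
def pull {X Y : C} (f : X ⟶ Y) (U : EOver E Y) : EOver E X :=
  haveI := E.hasPullback f U.prop
  ⟨Limits.pullback U.hom f, Limits.pullback.snd U.hom f, E.pullback_snd U.hom f U.prop⟩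

lemma pull_isPullback {X Y : C} (f : X ⟶ Y) (U : EOver E Y) :
    ∃ q : (pull f U).left ⟶ U.left, IsPullback q (pull f U).hom U.hom f :=
  haveI := E.hasPullback f U.prop
  ⟨_, IsPullback.of_hasPullback U.hom f⟩

lemma fac_pull_iff {A X Y : C} (h : A ⟶ X) (f : X ⟶ Y) (V : EOver E Y) :
    Fac h (pull f V) ↔ Fac (h ≫ f) V := by
  obtain ⟨q, hq⟩ := pull_isPullback f V
  constructor
  · rintro ⟨m, rfl⟩
    exact ⟨m ≫ q, by rw [Category.assoc, Category.assoc, hq.w]⟩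
  · rintro ⟨m, hm⟩
    exact ⟨hq.lift m h hm, hq.lift_snd _ _ _⟩

/-- The `ℰ`-morphism `U ×_X V → X`. -/
def meet [E.IsStableUnderComposition] {X : C} (U V : EOver E X) : EOver E X :=
  ⟨(pull U.hom V).left, (pull U.hom V).hom ≫ U.hom, E.comp_mem _ _ (pull U.hom V).prop U.prop⟩

lemma fac_meet_iff [E.IsStableUnderComposition] {A X : C} (h : A ⟶ X) (U V : EOver E X) :
    Fac h (meet U V) ↔ Fac h U ∧ Fac h V := by
  constructor
  · rintro ⟨m, rfl⟩
    refine ⟨⟨m ≫ (pull U.hom V).hom, Category.assoc _ _ _⟩, ?_⟩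
    exact ((fac_pull_iff _ _ _).mp (fac_self (pull U.hom V))).comp m
  · rintro ⟨⟨m, rfl⟩, h⟩
    obtain ⟨k, hk⟩ := (fac_pull_iff m U.hom V).mpr h
    exact ⟨k, by change k ≫ (pull U.hom V).hom ≫ U.hom = _; rw [← Category.assoc, hk]⟩

end EOver

end CohSite

open CohSite CohSite.EOver in
/-- A category `C` with a class `ℰ` of morphisms and a coherent Grothendieck topology `𝒪`: for each
object `X` a family `𝒪_X` of finite sets of `ℰ`-morphisms with target `X`. Only those axioms of a
coherent site are recorded that are needed for the lattices `Ω₁(X)` to be defined and to be small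
sets. -/
structure CohSite (C : Type (u + 1)) [Category.{u} C] where
  E : MorphismProperty C
  [isMultiplicative : E.IsMultiplicative]
  [isStableUnderBaseChange : E.IsStableUnderBaseChange]
  [hasPullbacks : E.HasPullbacks]
  mono : ∀ {X Y : C} (f : X ⟶ Y), E f → Mono f
  small : ∀ X : C, ∃ (ι : Type u) (F : ι → EOver E X), ∀ U : EOver E X, ∃ i,
    Fac U.hom (F i) ∧ Fac (F i).hom U
  cov : ∀ X : C, Set (Set (EOver E X))
  finite : ∀ {X : C} {S : Set (EOver E X)}, S ∈ cov X → S.Finite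
  iso_mem : ∀ {X : C} (U : EOver E X), IsIso U.hom → {U} ∈ cov X
  superset_mem : ∀ {X : C} {S T : Set (EOver E X)}, S ⊆ T → T.Finite → S ∈ cov X → T ∈ cov X
  pull_mem : ∀ {X Y : C} (f : X ⟶ Y) {S : Set (EOver E Y)}, S ∈ cov Y → pull f '' S ∈ cov X
  trans_mem : ∀ {X : C} {S T : Set (EOver E X)}, S ∈ cov X → T.Finite →
    (∀ V ∈ S, pull V.hom '' T ∈ cov V.left) → T ∈ cov X

namespace CohSite

open EOver

attribute [instance] isMultiplicative isStableUnderBaseChange hasPullbacks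

variable {C : Type (u + 1)} [Category.{u} C] (𝒞 : CohSite C)

/-- The set `Ω₀(X)` of finite sets of `ℰ`-morphisms with target `X`. -/
def Omega0 (X : C) : Type (u + 1) := {S : Set (EOver 𝒞.E X) // S.Finite}

variable {𝒞}

lemma singleton_pull_mem {A X : C} {h : A ⟶ X} {V : EOver 𝒞.E X} (H : Fac h V) :
    {pull h V} ∈ 𝒞.cov A := by
  apply 𝒞.iso_mem
  obtain ⟨m, hm⟩ : Fac (𝟙 A) (pull h V) := (fac_pull_iff _ _ _).mpr (by rwa [Category.id_comp])
  have := 𝒞.mono _ (pull h V).prop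
  exact ⟨m, by rw [← cancel_mono (pull h V).hom, Category.assoc, hm, Category.comp_id,
    Category.id_comp], hm⟩

lemma pull_image_mem {A X : C} {h : A ⟶ X} {T : Set (EOver 𝒞.E X)} (hT : T.Finite)
    (H : ∃ V ∈ T, Fac h V) : pull h '' T ∈ 𝒞.cov A := by
  obtain ⟨V, hV, H⟩ := H
  refine 𝒞.superset_mem ?_ (hT.image _) (singleton_pull_mem H)
  rintro _ rfl
  exact ⟨V, hV, rfl⟩

lemma refine_mem {X : C} {S T : Set (EOver 𝒞.E X)} (hS : S ∈ 𝒞.cov X) (hT : T.Finite)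
    (H : ∀ U ∈ S, ∃ V ∈ T, Fac U.hom V) : T ∈ 𝒞.cov X :=
  𝒞.trans_mem hS hT fun U hU => pull_image_mem hT (H U hU)

namespace Omega0

variable {X : C}

/-- The relation `{U_i} ≺ {V_j}`: for all `i`, the family `{U_i ×_X V_j → U_i}_j` is a covering. -/
def Prec (S T : 𝒞.Omega0 X) : Prop := ∀ U ∈ S.1, pull U.hom '' T.1 ∈ 𝒞.cov U.left

lemma prec_of_fac {S T : 𝒞.Omega0 X} (H : ∀ U ∈ S.1, ∃ V ∈ T.1, Fac U.hom V) : Prec S T :=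
  fun U hU => pull_image_mem T.2 (H U hU)

lemma Prec.refl (S : 𝒞.Omega0 X) : Prec S S := prec_of_fac fun U hU => ⟨U, hU, fac_self U⟩

/-- If `T` covers `U` and `q : A → U`, then a family that is refined by `T` on `A` covers `A`. -/
lemma transport {U A : C} {T : Set (EOver 𝒞.E X)} {R : Set (EOver 𝒞.E A)} {h : U ⟶ X}
    (hT : pull h '' T ∈ 𝒞.cov U) (q : A ⟶ U) (hR : R.Finite)
    (H : ∀ (B : C) (k : B ⟶ A), ∀ V ∈ T, Fac (k ≫ q ≫ h) V → ∃ W ∈ R, Fac k W) :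
    R ∈ 𝒞.cov A := by
  refine refine_mem (𝒞.pull_mem q hT) hR ?_
  rintro _ ⟨_, ⟨V, hV, rfl⟩, rfl⟩
  refine H _ _ V hV ?_
  have := (fac_pull_iff _ _ _).mp ((fac_pull_iff _ _ _).mp (fac_self (pull q (pull h V))))
  rwa [Category.assoc] at this

lemma Prec.trans {S T R : 𝒞.Omega0 X} (h : Prec S T) (h' : Prec T R) : Prec S R := by
  intro U hU
  refine 𝒞.trans_mem (h U hU) (R.2.image _) ?_
  rintro _ ⟨V, hV, rfl⟩
  obtain ⟨q, hq⟩ := pull_isPullback U.hom V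
  refine transport (h' V hV) q ((R.2.image _).image _) fun B k W hW H => ?_
  refine ⟨_, ⟨_, ⟨W, hW, rfl⟩, rfl⟩, ?_⟩
  rwa [fac_pull_iff, fac_pull_iff, Category.assoc, ← hq.w]

/-- The join `{U_i}_{i ∈ I} ∨ {U_i}_{i ∈ J} = {U_i}_{i ∈ I ∐ J}`. -/
def sup (S T : 𝒞.Omega0 X) : 𝒞.Omega0 X := ⟨S.1 ∪ T.1, S.2.union T.2⟩

/-- The meet `{U_i}_i ∧ {V_j}_j = {U_i ×_X V_j}_{i, j}`. -/
def inf (S T : 𝒞.Omega0 X) : 𝒞.Omega0 X := ⟨Set.image2 meet S.1 T.1, S.2.image2 _ T.2⟩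

lemma prec_sup_left (S T : 𝒞.Omega0 X) : Prec S (sup S T) :=
  prec_of_fac fun U hU => ⟨U, Or.inl hU, fac_self U⟩

lemma prec_sup_right (S T : 𝒞.Omega0 X) : Prec T (sup S T) :=
  prec_of_fac fun U hU => ⟨U, Or.inr hU, fac_self U⟩

lemma sup_prec {S T R : 𝒞.Omega0 X} (h : Prec S R) (h' : Prec T R) : Prec (sup S T) R := by
  rintro U (hU | hU)
  · exact h U hU
  · exact h' U hU

lemma inf_prec_left (S T : 𝒞.Omega0 X) : Prec (inf S T) S := prec_of_fac (by
  rintro _ ⟨U, hU, V, _, rfl⟩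
  exact ⟨U, hU, ((fac_meet_iff _ _ _).mp (fac_self (meet U V))).1⟩)

lemma inf_prec_right (S T : 𝒞.Omega0 X) : Prec (inf S T) T := prec_of_fac (by
  rintro _ ⟨U, _, V, hV, rfl⟩
  exact ⟨V, hV, ((fac_meet_iff _ _ _).mp (fac_self (meet U V))).2⟩)

lemma prec_inf {R S T : 𝒞.Omega0 X} (h : Prec R S) (h' : Prec R T) : Prec R (inf S T) := by
  intro W hW
  refine 𝒞.trans_mem (h W hW) ((inf S T).2.image _) ?_
  rintro _ ⟨U, hU, rfl⟩
  refine transport (h' W hW) (pull W.hom U).hom (((inf S T).2.image _).image _)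
    fun B k V hV H => ⟨_, ⟨_, ⟨meet U V, ⟨U, hU, V, hV, rfl⟩, rfl⟩, rfl⟩, ?_⟩
  rw [fac_pull_iff, fac_pull_iff, fac_meet_iff, Category.assoc]
  exact ⟨((fac_pull_iff _ _ _).mp (fac_self (pull W.hom U))).comp k, H⟩

/-- The base change of a finite family of `ℰ`-morphisms. -/
def base {Y : C} (f : Y ⟶ X) (S : 𝒞.Omega0 X) : 𝒞.Omega0 Y := ⟨pull f '' S.1, S.2.image _⟩

lemma Prec.base {Y : C} (f : Y ⟶ X) {S T : 𝒞.Omega0 X} (h : Prec S T) :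
    Prec (base f S) (base f T) := by
  rintro _ ⟨U, hU, rfl⟩
  obtain ⟨q, hq⟩ := pull_isPullback f U
  refine transport (h U hU) q ((T.2.image _).image _) fun B k V hV H =>
    ⟨_, ⟨_, ⟨V, hV, rfl⟩, rfl⟩, ?_⟩
  rwa [fac_pull_iff, fac_pull_iff, Category.assoc, ← hq.w]

end Omega0

variable (𝒞) in
/-- The equivalence relation on `Ω₀(X)` generated by `≺`. -/
def omegaSetoid (X : C) : Setoid (𝒞.Omega0 X) where
  r S T := S.Prec T ∧ T.Prec S
  iseqv := ⟨fun S => ⟨.refl S, .refl S⟩, fun h => ⟨h.2, h.1⟩,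
    fun h h' => ⟨h.1.trans h'.1, h'.2.trans h.2⟩⟩

variable (𝒞) in
/-- The distributive lattice `Ω₁(X) = Ω₀(X) / ≡`. -/
def Omega1 (X : C) : Type (u + 1) := Quotient (𝒞.omegaSetoid X)

namespace Omega1

variable {X : C}

/-- The class of a finite family of `ℰ`-morphisms. -/
def mk (S : 𝒞.Omega0 X) : 𝒞.Omega1 X := Quotient.mk _ S

lemma ind {p : 𝒞.Omega1 X → Prop} (h : ∀ S, p (mk S)) (x : 𝒞.Omega1 X) : p x := Quotient.ind h x

lemma mk_eq_iff {S T : 𝒞.Omega0 X} : mk S = mk T ↔ S.Prec T ∧ T.Prec S := Quotient.eq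

open Omega0

instance : Max (𝒞.Omega1 X) := ⟨Quotient.map₂ sup fun _ _ h _ _ h' =>
  ⟨sup_prec (h.1.trans (prec_sup_left _ _)) (h'.1.trans (prec_sup_right _ _)),
    sup_prec (h.2.trans (prec_sup_left _ _)) (h'.2.trans (prec_sup_right _ _))⟩⟩

instance : Min (𝒞.Omega1 X) := ⟨Quotient.map₂ inf fun _ _ h _ _ h' =>
  ⟨prec_inf ((inf_prec_left _ _).trans h.1) ((inf_prec_right _ _).trans h'.1),
    prec_inf ((inf_prec_left _ _).trans h.2) ((inf_prec_right _ _).trans h'.2)⟩⟩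

instance : PartialOrder (𝒞.Omega1 X) where
  le := Quotient.lift₂ Prec fun _ _ _ _ h h' => propext
    ⟨fun H => (h.2.trans H).trans h'.1, fun H => (h.1.trans H).trans h'.2⟩
  le_refl := ind Prec.refl
  le_trans := ind fun _ => ind fun _ => ind fun _ h h' => Prec.trans h h'
  le_antisymm := ind fun _ => ind fun _ h h' => mk_eq_iff.mpr ⟨h, h'⟩

lemma mk_le_iff {S T : 𝒞.Omega0 X} : mk S ≤ mk T ↔ S.Prec T := Iff.rfl

instance : Lattice (𝒞.Omega1 X) where
  sup x y := x ⊔ y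
  inf x y := x ⊓ y
  le_sup_left := ind fun S => ind fun T => prec_sup_left S T
  le_sup_right := ind fun S => ind fun T => prec_sup_right S T
  sup_le := ind fun _ => ind fun _ => ind fun _ => sup_prec
  inf_le_left := ind fun S => ind fun T => inf_prec_left S T
  inf_le_right := ind fun S => ind fun T => inf_prec_right S T
  le_inf := ind fun _ => ind fun _ => ind fun _ => prec_inf

instance : DistribLattice (𝒞.Omega1 X) :=
  DistribLattice.ofInfSupLe <| ind fun S => ind fun T => ind fun R => prec_of_fac (by
    rintro _ ⟨U, hU, V, hV | hV, rfl⟩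
    · exact ⟨_, Or.inl ⟨U, hU, V, hV, rfl⟩, fac_self _⟩
    · exact ⟨_, Or.inr ⟨U, hU, V, hV, rfl⟩, fac_self _⟩)

instance : BoundedOrder (𝒞.Omega1 X) where
  top := mk ⟨{EOver.refl X}, Set.finite_singleton _⟩
  bot := mk ⟨∅, Set.finite_empty⟩
  le_top := ind fun _ => prec_of_fac fun _ _ => ⟨EOver.refl X, rfl, fac_refl _⟩
  bot_le := ind fun _ => prec_of_fac fun _ hU => hU.elim

/-- The homomorphism `Ω₁(X) → Ω₁(Y)`, `{U_i} ↦ {Y ×_X U_i}`, induced by `f : Y → X`. -/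
def map {Y : C} (f : Y ⟶ X) : BoundedLatticeHom (𝒞.Omega1 X) (𝒞.Omega1 Y) where
  toFun := Quotient.map (base f) fun S T h => ⟨h.1.base f, h.2.base f⟩
  map_sup' := ind fun S => ind fun T => congrArg mk (Subtype.ext (Set.image_union _ _ _))
  map_inf' := ind fun S => ind fun T => mk_eq_iff.mpr ⟨prec_of_fac (by
    rintro _ ⟨_, ⟨U, hU, V, hV, rfl⟩, rfl⟩
    refine ⟨_, ⟨_, ⟨U, hU, rfl⟩, _, ⟨V, hV, rfl⟩, rfl⟩, ?_⟩
    rw [fac_meet_iff, fac_pull_iff, fac_pull_iff, ← fac_meet_iff, ← fac_pull_iff]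
    exact fac_self _), prec_of_fac (by
    rintro _ ⟨_, ⟨U, hU, rfl⟩, _, ⟨V, hV, rfl⟩, rfl⟩
    refine ⟨_, ⟨_, ⟨U, hU, V, hV, rfl⟩, rfl⟩, ?_⟩
    rw [fac_pull_iff, fac_meet_iff, ← fac_pull_iff, ← fac_pull_iff, ← fac_meet_iff]
    exact fac_self _)⟩
  map_top' := mk_eq_iff.mpr ⟨prec_of_fac fun U _ => ⟨EOver.refl Y, rfl, fac_refl _⟩,
    prec_of_fac fun U _ => ⟨_, ⟨EOver.refl X, rfl, rfl⟩, (fac_pull_iff _ _ _).mpr (fac_refl _)⟩⟩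
  map_bot' := congrArg mk (Subtype.ext (Set.image_empty _))

lemma map_mk {Y : C} (f : Y ⟶ X) (S : 𝒞.Omega0 X) : map f (mk S) = mk (base f S) := rfl

lemma map_id (x : 𝒞.Omega1 X) : map (𝟙 X) x = x := by
  induction x using ind with
  | h S =>
    refine mk_eq_iff.mpr ⟨prec_of_fac ?_, prec_of_fac fun U hU => ⟨_, ⟨U, hU, rfl⟩, ?_⟩⟩
    · rintro _ ⟨U, hU, rfl⟩
      refine ⟨U, hU, ?_⟩
      have := (fac_pull_iff _ _ _).mp (fac_self (pull (𝟙 X) U))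
      rwa [Category.comp_id] at this
    · rw [fac_pull_iff, Category.comp_id]
      exact fac_self U

lemma map_comp {Y Z : C} (g : Z ⟶ Y) (f : Y ⟶ X) (x : 𝒞.Omega1 X) :
    map (g ≫ f) x = map g (map f x) := by
  induction x using ind with
  | h S =>
    refine mk_eq_iff.mpr ⟨prec_of_fac ?_, prec_of_fac ?_⟩
    · rintro _ ⟨U, hU, rfl⟩
      refine ⟨_, ⟨_, ⟨U, hU, rfl⟩, rfl⟩, ?_⟩
      rw [fac_pull_iff, fac_pull_iff, Category.assoc, ← fac_pull_iff]
      exact fac_self _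
    · rintro _ ⟨_, ⟨U, hU, rfl⟩, rfl⟩
      refine ⟨_, ⟨U, hU, rfl⟩, ?_⟩
      rw [fac_pull_iff, ← Category.assoc, ← fac_pull_iff, ← fac_pull_iff]
      exact fac_self _

instance : Small.{u} (𝒞.Omega1 X) := by
  obtain ⟨ι, F, hF⟩ := 𝒞.small X
  refine small_of_surjective (α := {s : Set ι // s.Finite})
    (f := fun s => mk ⟨F '' s.1, s.2.image F⟩) (ind fun S => ?_)
  choose i hi hi' using hF
  refine ⟨⟨i '' S.1, S.2.image i⟩, mk_eq_iff.mpr ⟨prec_of_fac ?_, prec_of_fac fun U hU => ?_⟩⟩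
  · rintro _ ⟨_, ⟨U, hU, rfl⟩, rfl⟩
    exact ⟨U, hU, hi' U⟩
  · exact ⟨_, ⟨_, ⟨U, hU, rfl⟩, rfl⟩, hi U⟩

end Omega1

instance (L : Type (u + 1)) [DistribLattice L] [Small.{u} L] : DistribLattice (Shrink.{u} L) :=
  letI : Max (Shrink.{u} L) := ⟨fun a b => equivShrink L ((equivShrink L).symm a ⊔
    (equivShrink L).symm b)⟩
  letI : Min (Shrink.{u} L) := ⟨fun a b => equivShrink L ((equivShrink L).symm a ⊓
    (equivShrink L).symm b)⟩
  (equivShrink L).symm.injective.distribLattice _ Iff.rfl Iff.rfl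
    (fun _ _ => Equiv.symm_apply_apply _ _) (fun _ _ => Equiv.symm_apply_apply _ _)

instance (L : Type (u + 1)) [DistribLattice L] [BoundedOrder L] [Small.{u} L] :
    BoundedOrder (Shrink.{u} L) where
  le_top _ := le_top
  bot_le _ := bot_le

/-- A small lattice, as an isomorphic lattice in the universe `u`. -/
def shrinkIso (L : Type (u + 1)) [DistribLattice L] [BoundedOrder L] [Small.{u} L] :
    L ≃o Shrink.{u} L where
  toEquiv := equivShrink L
  map_rel_iff' := (orderIsoShrink.{u} L).map_rel_iff

/-- The homomorphism induced by `f : Y → X` between the small copies of the lattices `Ω₁`. -/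
def omegaMap {X Y : C} (f : Y ⟶ X) :
    BoundedLatticeHom (Shrink.{u} (𝒞.Omega1 X)) (Shrink.{u} (𝒞.Omega1 Y)) :=
  ((shrinkIso (𝒞.Omega1 Y) : BoundedLatticeHom (𝒞.Omega1 Y) (Shrink.{u} (𝒞.Omega1 Y))).comp
    (Omega1.map f)).comp
      ((shrinkIso (𝒞.Omega1 X)).symm : BoundedLatticeHom (Shrink.{u} (𝒞.Omega1 X)) (𝒞.Omega1 X))

lemma omegaMap_apply {X Y : C} (f : Y ⟶ X) (x : Shrink.{u} (𝒞.Omega1 X)) :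
    omegaMap f x = shrinkIso _ (Omega1.map f ((shrinkIso _).symm x)) := rfl

variable (𝒞) in
/-- The contravariant functor `Ω₁` to distributive lattices. -/
def omegaFunctor : Cᵒᵖ ⥤ BddDistLat.{u} where
  obj X := BddDistLat.of (Shrink.{u} (𝒞.Omega1 X.unop))
  map f := BddDistLat.ofHom (omegaMap f.unop)
  map_id X := by
    refine BddDistLat.ext fun x => ?_
    change omegaMap (𝟙 X.unop) x = x
    rw [omegaMap_apply, Omega1.map_id, OrderIso.apply_symm_apply]
  map_comp {X Y Z} f g := by
    refine BddDistLat.ext fun x => ?_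
    change omegaMap (g.unop ≫ f.unop) x = omegaMap g.unop (omegaMap f.unop x)
    rw [omegaMap_apply, omegaMap_apply, omegaMap_apply, Omega1.map_comp,
      OrderIso.symm_apply_apply]

end CohSite

namespace Coh

open CohSite CohSite.EOver

variable {D : Type (u + 1)} [Category.{u} D] (𝒞 : CohSite Dᵒᵖ)

/-- For `C = Dᵒᵖ`, the functor `R ↦ Ω₁(R)`, as a covariant functor on `D = Cᵒᵖ`. -/
def omegaLattice : D ⥤ BddDistLat.{u} := opOp D ⋙ 𝒞.omegaFunctor

/-- The element `{j}` of `Ω₁(R)`, for an `ℰ`-morphism `j : A → R`. -/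
def singleClass {R : D} (j : EOver 𝒞.E (op R)) : (omegaLattice 𝒞).obj R :=
  shrinkIso (𝒞.Omega1 (op R)) (Omega1.mk ⟨{j}, Set.finite_singleton j⟩)

/-- For quasi-compact open subsets `T ⊆ U`, the restriction `O_X(T) → O_X(U)`, which is a morphism
of `C = Dᵒᵖ`, factors through the `ℰ`-morphism `j : A → O_X(U)` whenever `β_X(U)({j}) ≥ T`. -/
def IsWeakScheme : ObjectProperty (SupportedSpace (omegaLattice 𝒞)) := fun X =>
  ∀ (T U : CompactOpens X.carrier) (h : T ≤ U) (j : EOver 𝒞.E (op (X.O.obj.obj (op U)))),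
    T ≤ X.support (singleClass 𝒞 j) → Fac (X.O.obj.map (homOfLE h).op).op j

/-- The category of weak `C`-schemes, for `C = Dᵒᵖ`. -/
abbrev WeakScheme : Type (u + 1) := (IsWeakScheme 𝒞).FullSubcategory

end Coh
/-! ### The Zariski topology -/

namespace WAlg

open CohSite CohSite.EOver

variable {V : AlgType.{u}}

section Localization

variable {R A B : WAlg V}

lemma IsLoc.congr {S T : Submonoid R} {g : R ⟶ A} (hg : IsLoc S g)
    (h : ∀ (B : WAlg V) (k : R ⟶ B),
      (∀ s ∈ S, IsUnit (k.hom s)) ↔ ∀ t ∈ T, IsUnit (k.hom t)) : IsLoc T g :=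
  ⟨(h A g).mp hg.1, fun B k hk => hg.2 B k ((h B k).mpr hk)⟩

lemma isUnit_powers_iff (k : R ⟶ B) (r : R) :
    (∀ s ∈ Submonoid.powers r, IsUnit (k.hom s)) ↔ IsUnit (k.hom r) := by
  constructor
  · exact fun h => h r (Submonoid.mem_powers r)
  · rintro h _ ⟨n, rfl⟩
    change IsUnit (k.hom (r ^ n))
    rw [map_pow]
    exact h.pow n

lemma isUnit_closure_iff (k : R ⟶ B) (t : Finset R) :
    (∀ s ∈ Submonoid.closure (t : Set R), IsUnit (k.hom s)) ↔ IsUnit (k.hom (∏ x ∈ t, x)) := by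
  constructor
  · exact fun h => h _ (Submonoid.prod_mem _ fun x hx => Submonoid.subset_closure hx)
  · intro h s hs
    induction hs using Submonoid.closure_induction with
    | mem x hx => exact isUnit_of_dvd_unit (map_dvd k.hom (Finset.dvd_prod_of_mem _ hx)) h
    | one => rw [map_one]; exact isUnit_one
    | mul x y _ _ hx hy => rw [map_mul]; exact hx.mul hy

lemma isLoc_of_isIso (g : R ⟶ A) [IsIso g] : IsLoc (Submonoid.powers 1) g := by
  refine ⟨(isUnit_powers_iff g 1).mpr (by rw [map_one]; exact isUnit_one), fun B h _ =>
    ⟨inv g ≫ h, by simp, fun k hk => ?_⟩⟩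
  rw [← hk, IsIso.inv_hom_id_assoc]

lemma IsLoc.comp {r x : R} {a : A} {n : ℕ} {g : R ⟶ A} {h : A ⟶ B}
    (hg : IsLoc (Submonoid.powers r) g) (hh : IsLoc (Submonoid.powers a) h)
    (e : g.hom (r ^ n) * a = g.hom x) : IsLoc (Submonoid.powers (r * x)) (g ≫ h) := by
  have hr := (isUnit_powers_iff g r).mp hg.1
  have ha := (isUnit_powers_iff h a).mp hh.1
  constructor
  · rw [isUnit_powers_iff, map_mul, comp_hom, comp_hom, ← e, map_mul, map_pow]
    exact (hr.map h.hom).mul (((hr.pow n).map h.hom).mul ha)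
  · intro C k hk
    rw [isUnit_powers_iff, map_mul, IsUnit.mul_iff] at hk
    obtain ⟨l, rfl, hl⟩ := hg.2 C k ((isUnit_powers_iff k r).mpr hk.1)
    have h2 := hk.2
    rw [comp_hom, ← e, map_mul, IsUnit.mul_iff] at h2
    obtain ⟨m, rfl, hm⟩ := hh.2 C l ((isUnit_powers_iff l a).mpr h2.2)
    refine ⟨m, Category.assoc _ _ _, fun m' hm' => hm _ (hl _ ?_)⟩
    rw [← hm']
    exact (Category.assoc _ _ _).symm

lemma isUnit_map_iff {S : Submonoid R} (f : R ⟶ A) (k : A ⟶ B) :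
    (∀ t ∈ S.map f.hom, IsUnit (k.hom t)) ↔ ∀ s ∈ S, IsUnit ((f ≫ k).hom s) :=
  ⟨fun h s hs => h _ ⟨s, hs, rfl⟩, by rintro h _ ⟨s, hs, rfl⟩; exact h s hs⟩

/-- Localizations are stable under cobase change. -/
lemma IsLoc.of_isPushout {P : WAlg V} {S : Submonoid R} {g : R ⟶ A} {f : R ⟶ B} {i : A ⟶ P}
    {j : B ⟶ P} (hg : IsLoc S g) (sq : IsPushout g f i j) : IsLoc (S.map f.hom) j := by
  constructor
  · rw [isUnit_map_iff, ← sq.w]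
    exact fun s hs => (hg.1 s hs).map i.hom
  · intro C k hk
    rw [isUnit_map_iff] at hk
    obtain ⟨l, hl, -⟩ := hg.2 C (f ≫ k) hk
    refine ⟨sq.desc l k hl, sq.inr_desc _ _ _, fun m hm => sq.hom_ext ?_ ?_⟩
    · obtain ⟨_, _, hu⟩ := hg.2 C (f ≫ k) hk
      rw [hu (i ≫ m) (by change g ≫ i ≫ m = _; rw [← Category.assoc, sq.w, Category.assoc, hm]),
        hu (i ≫ sq.desc l k hl) (by change g ≫ i ≫ _ = _; rw [sq.inl_desc, hl])]
    · rw [hm, sq.inr_desc]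

lemma IsLoc.epi {S : Submonoid R} {g : R ⟶ A} (hg : IsLoc S g) : Epi g := by
  refine ⟨fun {C} k l h => (hg.2 C (g ≫ k) fun s hs => ?_).unique rfl h.symm⟩
  exact (hg.1 s hs).map k.hom

/-- The cobase change of a localization. -/
lemma IsLoc.exists_isPushout {S : Submonoid R} {g : R ⟶ A} (hg : IsLoc S g) (f : R ⟶ B) :
    ∃ i : A ⟶ loc (S.map f.hom), IsPushout g f i (toLoc (S.map f.hom)) := by
  have hj := isLoc_toLoc (S.map f.hom)
  obtain ⟨i, hi, -⟩ := hg.2 _ (f ≫ toLoc (S.map f.hom)) ((isUnit_map_iff f _).mp hj.1)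
  have hu : ∀ {C : WAlg V} (k : A ⟶ C) (l : B ⟶ C), g ≫ k = f ≫ l →
      ∃! m, toLoc (S.map f.hom) ≫ m = l := fun {C} k l h => hj.2 C l <| by
    rw [isUnit_map_iff, ← h]
    exact fun s hs => (hg.1 s hs).map k.hom
  have := hg.epi
  refine ⟨i, ⟨⟨hi⟩, ⟨Limits.PushoutCocone.IsColimit.mk hi
    (fun s => (hu s.inl s.inr s.condition).choose) (fun s => ?_) (fun s => ?_)
    (fun s m h1 h2 => (hu s.inl s.inr s.condition).unique h2 ?_)⟩⟩⟩
  · rw [← cancel_epi g, ← Category.assoc, hi, Category.assoc,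
      (hu s.inl s.inr s.condition).choose_spec.1, s.condition]
  · exact (hu s.inl s.inr s.condition).choose_spec.1
  · exact (hu s.inl s.inr s.condition).choose_spec.1

end Localization

variable (V) in
/-- The localizations of finite type `S⁻¹R → R`, as morphisms of the opposite category of
`W`-algebras: the multiplicative system `S` is finitely generated. -/
def finTypeLoc : MorphismProperty (WAlg V)ᵒᵖ := fun _ Y f =>
  ∃ S : Submonoid Y.unop, S.FG ∧ IsLoc S f.unop

lemma finTypeLoc_iff {X Y : (WAlg V)ᵒᵖ} (f : X ⟶ Y) :
    finTypeLoc V f ↔ ∃ r : Y.unop, IsLoc (Submonoid.powers r) f.unop := by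
  constructor
  · rintro ⟨_, ⟨t, rfl⟩, h⟩
    exact ⟨∏ x ∈ t, x, h.congr fun B k => by rw [isUnit_closure_iff, isUnit_powers_iff]⟩
  · rintro ⟨r, h⟩
    exact ⟨_, ⟨{r}, by rw [Finset.coe_singleton, Submonoid.powers_eq_closure]⟩, h⟩

instance : (finTypeLoc V).IsMultiplicative where
  id_mem X := (finTypeLoc_iff _).mpr ⟨1, isLoc_of_isIso (𝟙 X.unop)⟩
  comp_mem f g hf hg := by
    rw [finTypeLoc_iff] at hf hg ⊢
    obtain ⟨a, ha⟩ := hf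
    obtain ⟨r, hr⟩ := hg
    obtain ⟨_, ⟨n, rfl⟩, x, hx⟩ := hr.surj a
    exact ⟨r * x, hr.comp ha hx⟩

instance : (finTypeLoc V).IsStableUnderBaseChange where
  of_isPullback {X Y Y' Z f g f' g'} sq hg := by
    obtain ⟨S, hS, h⟩ := hg
    exact ⟨S.map f.unop.hom, hS.map _, h.of_isPushout sq.unop.flip⟩

instance : (finTypeLoc V).HasPullbacks where
  hasPullback {X Y Z f} g hf := by
    obtain ⟨S, hS, h⟩ := hf
    obtain ⟨i, hi⟩ := h.exists_isPushout g.unop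
    exact hi.op.flip.hasPullback

lemma isLoc_pull {X Y : (WAlg V)ᵒᵖ} (f : X ⟶ Y) (U : EOver (finTypeLoc V) Y) {r : Y.unop}
    (h : IsLoc (Submonoid.powers r) U.hom.unop) :
    IsLoc (Submonoid.powers (f.unop.hom r)) (pull f U).hom.unop := by
  obtain ⟨q, hq⟩ := pull_isPullback f U
  have := h.of_isPushout hq.unop.flip
  rwa [Submonoid.map_powers] at this

variable (V) in
/-- The Zariski coverings: the finite sets `{R_{f_i} → R}_i` such that the ideal generated by the
elements `f_i` is the unit ideal. -/
def zariskiCov (X : (WAlg V)ᵒᵖ) : Set (Set (EOver (finTypeLoc V) X)) :=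
  {S | ∃ (n : ℕ) (f : Fin n → X.unop) (U : Fin n → EOver (finTypeLoc V) X),
    (∀ i, IsLoc (Submonoid.powers (f i)) (U i).hom.unop) ∧ Set.range U = S ∧
      Idl.span (Set.range f) = 1}

lemma mem_zariskiCov_of_finite {X : (WAlg V)ᵒᵖ} {S : Set (EOver (finTypeLoc V) X)} {ι : Type*}
    [Finite ι] (f : ι → X.unop) (U : ι → EOver (finTypeLoc V) X)
    (h : ∀ i, IsLoc (Submonoid.powers (f i)) (U i).hom.unop) (hS : Set.range U = S)
    (hf : Idl.span (Set.range f) = 1) : S ∈ zariskiCov V X := by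
  obtain ⟨n, ⟨e⟩⟩ := Finite.exists_equiv_fin ι
  exact ⟨n, f ∘ e.symm, U ∘ e.symm, fun i => h _, by rw [e.symm.surjective.range_comp, hS],
    by rw [e.symm.surjective.range_comp, hf]⟩

lemma exists_elements {X : (WAlg V)ᵒᵖ} {T : Set (EOver (finTypeLoc V) X)} (hT : T.Finite) :
    ∃ (n : ℕ) (f : Fin n → X.unop) (U : Fin n → EOver (finTypeLoc V) X),
      (∀ i, IsLoc (Submonoid.powers (f i)) (U i).hom.unop) ∧ Set.range U = T := by
  have := hT.to_subtype
  obtain ⟨n, ⟨e⟩⟩ := Finite.exists_equiv_fin T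
  choose f hf using fun i => (finTypeLoc_iff (e.symm i).1.hom).mp (e.symm i).1.prop
  refine ⟨n, f, fun i => (e.symm i).1, hf, ?_⟩
  rw [show (fun i => (e.symm i).1) = Subtype.val ∘ e.symm from rfl, e.symm.surjective.range_comp,
    Subtype.range_val]

lemma zariski_pull_mem {X Y : (WAlg V)ᵒᵖ} (f : X ⟶ Y) {S : Set (EOver (finTypeLoc V) Y)}
    (hS : S ∈ zariskiCov V Y) : pull f '' S ∈ zariskiCov V X := by
  obtain ⟨n, a, U, hU, rfl, ha⟩ := hS
  refine ⟨n, fun i => f.unop.hom (a i), fun i => pull f (U i), fun i => isLoc_pull f _ (hU i),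
    Set.range_comp (pull f) U, ?_⟩
  rw [show (fun i => f.unop.hom (a i)) = f.unop.hom ∘ a from rfl, Set.range_comp, ← Idl.map_span,
    ha]
  exact Idl.map_one' _

lemma zariski_trans_mem {X : (WAlg V)ᵒᵖ} {S T : Set (EOver (finTypeLoc V) X)}
    (hS : S ∈ zariskiCov V X) (hT : T.Finite)
    (h : ∀ U ∈ S, pull U.hom '' T ∈ zariskiCov V U.left) : T ∈ zariskiCov V X := by
  obtain ⟨n, f, U, hU, rfl, hf⟩ := hS
  obtain ⟨m, g, W, hW, rfl⟩ := exists_elements hT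
  refine ⟨m, g, W, hW, rfl, ?_⟩
  set J := Idl.span (Set.range g)
  have key : ∀ i, ∃ k : ℕ, f i ^ k ∈ J := by
    intro i
    obtain ⟨l, a, Z, hZ, hZr, ha⟩ := h _ ⟨i, rfl⟩
    set φ : X.unop ⟶ (U i).left.unop := (U i).hom.unop
    have h1 : ∀ j, ∃ k : ℕ, a j ^ k ∈ Idl.map φ J := by
      intro j
      have hj : Z j ∈ pull (U i).hom '' Set.range W := hZr ▸ ⟨j, rfl⟩
      obtain ⟨_, ⟨p, rfl⟩, hp⟩ := hj
      have h2 := hZ j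
      rw [← hp] at h2
      have h3 := isLoc_pull (U i).hom _ (hW p)
      have h4 : Idl.map (pull (U i).hom (W p)).hom.unop (Idl.map φ J) = 1 := by
        rw [Idl.eq_one_iff]
        obtain ⟨c, hc⟩ := ((isUnit_powers_iff _ _).mp h3.1).exists_left_inv
        rw [← hc]
        refine Idl.mul_mem _ _ _ (Idl.subset_span _ ⟨_, Idl.subset_span _ ⟨g p,
          Idl.subset_span _ ⟨p, rfl⟩, rfl⟩, rfl⟩)
      obtain ⟨_, ⟨k, rfl⟩, hk⟩ := h2.of_mem_map (Idl.map φ J) (x := 1) (by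
        rw [h4]; exact Idl.mem_one _)
      exact ⟨k, by rwa [mul_one] at hk⟩
    obtain ⟨N, hN⟩ := Idl.pow_span_le (Set.finite_range a) (J := Idl.map φ J) (by
      rintro _ ⟨j, rfl⟩; exact h1 j)
    rw [ha, one_pow] at hN
    obtain ⟨_, ⟨k, rfl⟩, hk⟩ := (hU i).of_mem_map J (x := 1) (by
      change φ.hom 1 ∈ Idl.map φ J
      exact hN (Idl.mem_one _))
    exact ⟨k, by rwa [mul_one] at hk⟩
  obtain ⟨N, hN⟩ := Idl.pow_span_le (Set.finite_range f) (J := J) (by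
    rintro _ ⟨i, rfl⟩; exact key i)
  rw [hf, one_pow] at hN
  exact le_antisymm (Idl.le_one _) hN

variable (V) in
/-- The opposite category of `W`-algebras, with the Zariski topology. -/
def zariskiSite : CohSite.{u} (WAlg V)ᵒᵖ where
  E := finTypeLoc V
  mono f hf := by
    obtain ⟨S, -, h⟩ := hf
    have := h.epi
    exact inferInstanceAs (Mono f.unop.op)
  small X := by
    refine ⟨X.unop, fun r => ⟨op (loc (Submonoid.powers r)), (toLoc (Submonoid.powers r)).op,
      (finTypeLoc_iff _).mpr ⟨r, isLoc_toLoc _⟩⟩, fun U => ?_⟩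
    obtain ⟨r, hr⟩ := (finTypeLoc_iff _).mp U.prop
    obtain ⟨e, he⟩ := hr.exists_iso _ (isLoc_toLoc (Submonoid.powers r))
    obtain ⟨e', he'⟩ := (isLoc_toLoc (Submonoid.powers r)).exists_iso _ hr
    exact ⟨r, ⟨e'.hom.op, Quiver.Hom.unop_inj he'⟩, ⟨e.hom.op, Quiver.Hom.unop_inj he⟩⟩
  cov := zariskiCov V
  finite := by
    rintro X _ ⟨n, f, U, -, rfl, -⟩
    exact Set.finite_range U
  iso_mem {X} U hU := by
    refine mem_zariskiCov_of_finite (ι := Unit) (fun _ => 1) (fun _ => U) (fun _ => ?_)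
      Set.range_const ?_
    · exact isLoc_of_isIso U.hom.unop
    · rw [Set.range_const, Idl.span_one]
  superset_mem {X S T} hST hT hS := by
    obtain ⟨n, f, U, hU, rfl, hf⟩ := hS
    obtain ⟨m, g, W, hW, rfl⟩ := exists_elements hT
    refine mem_zariskiCov_of_finite (Sum.elim f g) (Sum.elim U W) (fun i => ?_) ?_ ?_
    · cases i with
      | inl i => exact hU i
      | inr i => exact hW i
    · rw [Set.Sum.elim_range, Set.union_eq_right.mpr hST]
    · rw [Set.Sum.elim_range]
      exact le_antisymm (Idl.le_one _)
        (hf.symm.le.trans (Idl.span_mono Set.subset_union_left))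
  pull_mem := zariski_pull_mem
  trans_mem := zariski_trans_mem

end WAlg

end

/-! Both kinds of schemes are coherent spaces with a structure sheaf and a support morphism; they
differ only in the lattice functor and in the wording of the factorization condition. The theorem
holds because the two functors, `α₁` and `Ω₁` for the Zariski topology, are naturally isomorphic,
and because the two conditions correspond under this isomorphism.

The isomorphism sends a finite family of localizations `R_{f_i} → R` to the radical class of the
ideal generated by the `f_i`. It rests on one observation, `RadIdl.principal_le_iff`: the class of
`a` lies below `x` exactly when `x` becomes `⊤` in the lattice of `R_a`. Hence the class of a family
is the least `x` that becomes `⊤` on none but its upper bounds: `x` lies above it exactly when `x`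
becomes `⊤` on every member (`radOfFamily_le_iff`). This description mentions only the localizations
and not the elements defining them, so the class does not depend on the `f_i`, and it commutes with
base change. A family covers exactly when its class is `⊤`, because only the unit ideal has that
class. Applied to the base changes of a family `T` to the members of `S`, this turns `S ≺ T` into an
inequality of classes (`forall_pull_mem_zariskiCov_iff`). Every finitely generated ideal arises from
the localizations at its generators, so an isomorphism of lattices results.

A natural isomorphism of lattice functors leaves spaces, sheaves and underlying pairs `(f, f^♯)`
untouched and only composes the support morphism with an isomorphism
(`SupportedSpace.changeLattice`). The factorization conditions agree because a homomorphism factors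
through a localization exactly when it inverts each element of the multiplicative system
(`IsLoc.exists_fac_iff`): factoring through one large localization is the same as factoring through
`R_a` for each `a` in the system. -/

noncomputable section

/-! ### Inequalities of radical classes, tested on generators and on localizations -/

namespace WAlg.RadIdl

variable {V : AlgType.{u}} {R A : WAlg V}

lemma fg_span {s : Set R} (hs : s.Finite) : (Idl.span s).FG := ⟨s, hs, rfl⟩

/-- A power of a finitely generated ideal lies in `J` as soon as some power of each generator does.
So the class of an ideal is the join of the principal classes of its generators, and inequalities
can be checked one generator at a time. -/
lemma mk_span_le_iff {s : Set R} (hs : s.Finite) (x : RadIdl R) :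
    mk (Idl.span s) (fg_span hs) ≤ x ↔ ∀ a ∈ s, principal a ≤ x := by
  induction x using ind with
  | h J hJ =>
    have hmem : ∀ a : R, principal a ≤ mk J hJ ↔ ∃ n : ℕ, a ^ n ∈ J := fun a => by
      -- One direction evaluates the inclusion of ideals at `a ^ n`, which lies in the `n`-th power
      -- of the ideal generated by `a`; the induction below proves this membership.
      refine mk_le_iff.trans ⟨fun ⟨n, h⟩ => ⟨n, h ?_⟩, fun ⟨n, h⟩ =>
        Idl.pow_span_le (Set.finite_singleton a) (by rintro _ rfl; exact ⟨n, h⟩)⟩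
      clear h
      induction n with
      | zero => rw [pow_zero, pow_zero]; exact Idl.mem_one _
      | succ n ih =>
        rw [pow_succ, pow_succ]
        exact Idl.mul_mem_mul ih (Idl.subset_span _ rfl)
    refine ⟨fun h a ha => le_trans (mk_le_iff.mpr ⟨1, ?_⟩) h, fun h => ?_⟩
    · rw [pow_one]
      exact Idl.span_mono (Set.singleton_subset_iff.mpr ha)
    -- The exponents depend on the generator; finiteness of `s` yields a common exponent for the
    -- whole ideal.
    · exact mk_le_iff.mpr (Idl.pow_span_le hs fun a ha => (hmem a).mp (h a ha))

/-- Products become meets, and meets are idempotent. This absorbs the exponents introduced by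
localizing at the powers of `a`. -/
lemma principal_le_principal_pow (a : R) (n : ℕ) : principal a ≤ principal (a ^ n) := by
  induction n with
  | zero => rw [pow_zero, principal_one]; exact le_top
  | succ n ih => rw [pow_succ, principal_mul]; exact le_inf ih le_rfl

/-- All powers of the unit ideal are the unit ideal, so no other ideal is radically equivalent to
it. The covering condition, which concerns ideals themselves, can therefore be read off from
classes. -/
lemma mk_eq_top_iff {I : Idl R} {hI : I.FG} : mk I hI = ⊤ ↔ I = 1 := by
  refine ⟨fun h => ?_, fun h => by subst h; rfl⟩
  obtain ⟨n, hn⟩ := mk_le_iff.mp (show mk 1 fg_one ≤ mk I hI from h.ge)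
  rw [one_pow] at hn
  exact le_antisymm (Idl.le_one I) hn

/-- The localization at `a` makes an element of the lattice trivial if and only if that element
contains the principal ideal generated by `a`. -/
lemma principal_le_iff {a : R} {g : R ⟶ A} (hg : IsLoc (Submonoid.powers a) g) (x : RadIdl R) :
    principal a ≤ x ↔ map g x = ⊤ := by
  -- Writing `⊤` as the image of `⊤` reduces the claim to comparing `⊤` and `x` after localization,
  -- which means `⊤ ⊓ principal s ≤ x` for some power `s` of `a`.
  rw [← top_le_iff, ← map_top (map g), map_le_iff hg]
  constructor
  · exact fun h => ⟨a, Submonoid.mem_powers a, inf_le_right.trans h⟩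
  · rintro ⟨_, ⟨n, rfl⟩, h⟩
    exact (principal_le_principal_pow a n).trans ((le_inf le_top le_rfl).trans h)

end WAlg.RadIdl

/-! ### Families of localizations and the ideal classes they define -/

namespace WAlg

open CohSite CohSite.EOver

variable {V : AlgType.{u}}

/-- An element at which a localization of finite type is the localization. -/
def element {X : (WAlg V)ᵒᵖ} (U : EOver (finTypeLoc V) X) : X.unop :=
  ((finTypeLoc_iff U.hom).mp U.prop).choose

lemma isLoc_element {X : (WAlg V)ᵒᵖ} (U : EOver (finTypeLoc V) X) :
    IsLoc (Submonoid.powers (element U)) U.hom.unop :=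
  ((finTypeLoc_iff U.hom).mp U.prop).choose_spec

/-- The ideal class of a finite family of localizations `R_{f_i} → R`, generated by the `f_i`. -/
def radOfFamily {X : (WAlg V)ᵒᵖ} {S : Set (EOver (finTypeLoc V) X)} (hS : S.Finite) :
    RadIdl X.unop :=
  RadIdl.mk (Idl.span (element '' S)) (RadIdl.fg_span (hS.image _))

section
variable {X : (WAlg V)ᵒᵖ} {S : Set (EOver (finTypeLoc V) X)} (hS : S.Finite)

/-- The upper bounds of the class are expressed by the localizations alone, without the chosen
elements. Since an element of a partial order is determined by its upper bounds, the independence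
and base change statements below follow from this. -/
lemma radOfFamily_le_iff (x : RadIdl X.unop) :
    radOfFamily hS ≤ x ↔ ∀ U ∈ S, RadIdl.map U.hom.unop x = ⊤ := by
  rw [radOfFamily, RadIdl.mk_span_le_iff (hS.image _), Set.forall_mem_image]
  exact forall₂_congr fun U _ => RadIdl.principal_le_iff (isLoc_element U) x

/-- Both classes have the same upper bounds. A covering comes with its own elements `f i`, which
need not be those picked by `element`; this lemma lets one set replace the other. -/
lemma radOfFamily_range {ι : Type*} [Finite ι] (f : ι → X.unop)
    {U : ι → EOver (finTypeLoc V) X} (h : ∀ i, IsLoc (Submonoid.powers (f i)) (U i).hom.unop)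
    (hU : (Set.range U).Finite) :
    radOfFamily hU = RadIdl.mk (Idl.span (Set.range f)) (RadIdl.fg_span (Set.finite_range f)) := by
  refine eq_of_forall_ge_iff fun x => ?_
  rw [radOfFamily_le_iff, RadIdl.mk_span_le_iff (Set.finite_range f), Set.forall_mem_range, Set.forall_mem_range]
  exact forall_congr' fun i => (RadIdl.principal_le_iff (h i) x).symm

lemma radOfFamily_singleton (U : EOver (finTypeLoc V) X) {a : X.unop}
    (h : IsLoc (Submonoid.powers a) U.hom.unop) :
    radOfFamily (Set.finite_singleton U) = RadIdl.principal a := by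
  refine eq_of_forall_ge_iff fun x => ?_
  rw [radOfFamily_le_iff, RadIdl.principal_le_iff h]
  simp only [Set.mem_singleton_iff, forall_eq]

/-- The base change of the localization at `a` is the localization at the image of `a`. The element
chosen for the base change may differ from that image, so upper bounds are compared instead of
generators. -/
lemma radOfFamily_pull {Y : (WAlg V)ᵒᵖ} (f : Y ⟶ X) :
    radOfFamily (hS.image (pull f)) = RadIdl.map f.unop (radOfFamily hS) := by
  refine eq_of_forall_ge_iff fun x => ?_
  -- The right side is presented by the images of the chosen elements, so that it too can be tested
  -- generator by generator.
  have h : RadIdl.map f.unop (radOfFamily hS) = RadIdl.mk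
      (Idl.span (f.unop.hom '' (element '' S))) (RadIdl.fg_span ((hS.image _).image _)) := by
    rw [radOfFamily, RadIdl.map_mk]
    congr 1
    exact Idl.map_span _ _
  rw [h, radOfFamily_le_iff, RadIdl.mk_span_le_iff ((hS.image _).image _), Set.forall_mem_image, Set.forall_mem_image,
    Set.forall_mem_image]
  exact forall₂_congr fun U _ => (RadIdl.principal_le_iff (isLoc_pull f U (isLoc_element U)) x).symm

/-- Whether a family covers can be tested on any choice of defining elements: all choices have the
same class, and a class is `⊤` only for the unit ideal. -/
lemma mem_zariskiCov_iff : S ∈ zariskiCov V X ↔ radOfFamily hS = ⊤ := by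
  constructor
  · rintro ⟨n, f, U, hU, rfl, hf⟩
    rwa [radOfFamily_range f hU, RadIdl.mk_eq_top_iff]
  · intro h
    obtain ⟨n, f, U, hU, rfl⟩ := exists_elements hS
    rw [radOfFamily_range f hU, RadIdl.mk_eq_top_iff] at h
    exact ⟨n, f, U, hU, rfl, h⟩

/-- The base change of `T` to a member `U` of `S` covers exactly when the class of `T` becomes `⊤`
over `U`. Requiring this for all `U` is the description of the upper bounds of the class of `S`. -/
lemma forall_pull_mem_zariskiCov_iff {T : Set (EOver (finTypeLoc V) X)} (hT : T.Finite) :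
    (∀ U ∈ S, pull U.hom '' T ∈ zariskiCov V U.left) ↔ radOfFamily hS ≤ radOfFamily hT := by
  rw [radOfFamily_le_iff]
  refine forall₂_congr fun U _ => ?_
  rw [mem_zariskiCov_iff (hT.image _), radOfFamily_pull]

end

/-- The localizations at the members of a finite generating set form such a family. This gives
surjectivity of the comparison map. -/
lemma exists_radOfFamily_eq {X : (WAlg V)ᵒᵖ} (x : RadIdl X.unop) :
    ∃ (S : Set (EOver (finTypeLoc V) X)) (hS : S.Finite), radOfFamily hS = x := by
  induction x using RadIdl.ind with
  | h I hI =>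
    obtain ⟨s, hs, rfl⟩ := hI
    have := hs.to_subtype
    let U : s → EOver (finTypeLoc V) X := fun a =>
      ⟨op (loc (Submonoid.powers a.1)), (toLoc (Submonoid.powers a.1)).op,
        (finTypeLoc_iff _).mpr ⟨a.1, isLoc_toLoc _⟩⟩
    refine ⟨Set.range U, Set.finite_range U, ?_⟩
    rw [radOfFamily_range Subtype.val fun a => isLoc_toLoc _]
    congr 1
    rw [Subtype.range_val]

/-! ### The natural isomorphism between `Ω₁` and `α₁` -/

lemma prec_iff {X : (WAlg V)ᵒᵖ} (S T : (zariskiSite V).Omega0 X) :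
    S.Prec T ↔ radOfFamily S.2 ≤ radOfFamily T.2 :=
  forall_pull_mem_zariskiCov_iff S.2 T.2

/-- The lattice `Ω₁(R)` of the Zariski topology is the lattice of finitely generated ideals of `R`
modulo radical equivalence. -/
def omegaOrderIso (X : (WAlg V)ᵒᵖ) : (zariskiSite V).Omega1 X ≃o RadIdl X.unop :=
  -- Preserving and reflecting the order makes the map on classes well defined and injective, by
  -- antisymmetry. As an order isomorphism it respects joins, meets and bounds, so these need no
  -- separate check.
  RelIso.ofSurjective
    (OrderEmbedding.ofMapLEIff
      (Quotient.lift (fun S => radOfFamily S.2) fun S T h =>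
        le_antisymm ((prec_iff S T).mp h.1) ((prec_iff T S).mp h.2))
      (Omega1.ind fun S => Omega1.ind fun T => (prec_iff S T).symm))
    fun x => by
      obtain ⟨S, hS, h⟩ := exists_radOfFamily_eq x
      exact ⟨Omega1.mk ⟨S, hS⟩, h⟩

lemma omegaOrderIso_map {X Y : (WAlg V)ᵒᵖ} (f : Y ⟶ X) (x : (zariskiSite V).Omega1 X) :
    omegaOrderIso Y (Omega1.map f x) = RadIdl.map f.unop (omegaOrderIso X x) := by
  induction x using Omega1.ind with
  | h S => exact radOfFamily_pull S.2 f

variable (V) in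
/-- The natural isomorphism between `Ω₁` for the Zariski topology and `α₁`. -/
def omegaIsoRad : Coh.omegaLattice (zariskiSite V) ≅ radFunctor V :=
  NatIso.ofComponents
    (fun R => BddDistLat.Iso.mk ((shrinkIso ((zariskiSite V).Omega1 (op R))).symm.trans
      (omegaOrderIso (op R))))
    fun {R S} f => by
      refine BddDistLat.ext fun x => ?_
      change omegaOrderIso (op S) ((shrinkIso _).symm (omegaMap f.op x)) =
        RadIdl.map f (omegaOrderIso (op R) ((shrinkIso _).symm x))
      -- The passages to and from the small copy of the lattice cancel, leaving naturality for `Ω₁`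
      -- itself.
      exact (congrArg (omegaOrderIso (op S)) (OrderIso.symm_apply_apply _ _)).trans
        (omegaOrderIso_map f.op _)

/-- The two factorization conditions test supports of different elements, `{j}` in `Ω₁(R)` and
`α₂(a)` in `α₁(R)`; here they are matched, for any `a` at which `j` is the localization. -/
lemma omegaIsoRad_singleClass {R : WAlg V} (j : EOver (zariskiSite V).E (op R)) {a : R}
    (h : IsLoc (Submonoid.powers a) j.hom.unop) :
    (omegaIsoRad V).hom.app R (Coh.singleClass (zariskiSite V) j) = RadIdl.principal a := by
  change omegaOrderIso (op R) ((shrinkIso _).symm (shrinkIso _ _)) = _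
  rw [OrderIso.symm_apply_apply]
  exact radOfFamily_singleton j h

end WAlg

/-! ### Supported spaces under a change of lattice functor -/

namespace Coh

variable {D : Type (u + 1)} [Category.{u} D] {L L' : D ⥤ BddDistLat.{u}}

section
variable {X : Type u} [TopologicalSpace X] [SpectralSpace X]

/-- The morphism of lattice sheaves induced by a natural transformation `L ⟶ L'`. -/
def latticeSheafTrans (η : L ⟶ L') (O : Sheaf (topology X) D) :
    latticeSheaf L O ⟶ latticeSheaf L' O :=
  (presheafToSheaf (topology X) BddDistLat.{u}).map (Functor.whiskerLeft O.obj η)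

/-- The unit of sheafification is natural. Thus the effect of the change on supports is computed on
elements of `L (O U)`, and sections of the sheafification never have to be handled. -/
lemma supp_latticeSheafTrans (η : L ⟶ L') {O : Sheaf (topology X) D}
    (β : latticeSheaf L' O ⟶ tau X) {U : CompactOpens X} (a : L.obj (O.obj.obj (op U))) :
    supp L (latticeSheafTrans η O ≫ β) a = supp L' β (η.app _ a) := by
  have h : toLatticeSheaf L O ≫ (latticeSheafTrans η O).hom =
      Functor.whiskerLeft O.obj η ≫ toLatticeSheaf L' O :=
    (toSheafify_naturality (topology X) (Functor.whiskerLeft O.obj η)).symm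
  exact congrArg (fun k => Subtype.val (β.hom.app (op U) (k.app (op U) a))) h

end

namespace SupportedSpace

/-- Change of the lattice functor along a natural transformation `L ⟶ L'`. -/
def changeLattice (η : L ⟶ L') : SupportedSpace L' ⥤ SupportedSpace L where
  obj X := { carrier := X.carrier, O := X.O, β := latticeSheafTrans η X.O ≫ X.β }
  map {X Y} f :=
    { base := f.base
      isSpectralMap := f.isSpectralMap
      sharp := f.sharp
      comm := by
        -- Tested on elements, compatibility for `L` at `a` is compatibility for `L'` at the image
        -- of `a` under `η`, by naturality of `η` along `f^♯`.
        refine (comm_iff L _ _ _ _ _).mpr fun U a => ?_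
        refine (supp_latticeSheafTrans η X.β _).trans (Eq.trans ?_
          (congrArg (preimage f.base f.isSpectralMap) (supp_latticeSheafTrans η Y.β a).symm))
        refine Eq.trans ?_ ((comm_iff L' _ _ _ _ _).mp f.comm U (η.app _ a))
        exact congrArg (supp L' X.β) (congrArg (fun k => k a)
          (η.naturality (f.sharp.hom.app (op U)))) }

lemma changeLattice_support (η : L ⟶ L') (X : SupportedSpace L') {U : CompactOpens X.carrier}
    (a : L.obj (X.O.obj.obj (op U))) :
    ((changeLattice η).obj X).support (U := U) a = X.support (η.app _ a) :=
  supp_latticeSheafTrans η X.β a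

/-- The functor keeps the data `(f, f^♯)`, and compatibility with supports is only a property of the
pair. -/
instance (η : L ⟶ L') : (changeLattice η).Faithful where
  map_injective {X Y f g} h := by
    obtain ⟨b, hb, s, hs⟩ := f
    obtain ⟨b', hb', s', hs'⟩ := g
    obtain ⟨rfl, h⟩ := (Hom.ext_iff).mp h
    exact Hom.ext rfl h

/-- The same pair `(f, f^♯)` serves as preimage. Its compatibility has to be tested on elements of
`L'`, all of which are images of elements of `L` because `η` is invertible. -/
instance (η : L ⟶ L') [IsIso η] : (changeLattice η).Full where
  map_surjective {X Y} f := by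
    refine ⟨⟨f.base, f.isSpectralMap, f.sharp, ?_⟩, rfl⟩
    refine (comm_iff L' _ _ _ _ _).mpr fun U a => ?_
    obtain ⟨a, rfl⟩ : ∃ b, η.app _ b = a :=
      ⟨(inv η).app _ a, congrArg (fun k => k.app (Y.O.obj.obj (op U)) a) (IsIso.inv_hom_id η)⟩
    refine Eq.trans ?_ ((((comm_iff L _ _ _ _ _).mp f.comm U a).trans (congrArg _ (supp_latticeSheafTrans η Y.β a))))
    refine Eq.trans ?_ (supp_latticeSheafTrans η X.β _).symm
    exact congrArg (supp L' X.β) (congrArg (fun k => k a)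
      (η.naturality (f.sharp.hom.app (op U)))).symm

/-- Space and sheaf do not change, so only the support morphisms are compared, and there `η` cancels
against its inverse. Because this is an equality of objects, properties can be transported along it
directly. -/
lemma changeLattice_obj_inv (η : L ⟶ L') [IsIso η] (X : SupportedSpace L) :
    (changeLattice η).obj ((changeLattice (inv η)).obj X) = X := by
  change SupportedSpace.mk X.carrier X.O _ = SupportedSpace.mk X.carrier X.O X.β
  congr 1
  change latticeSheafTrans η X.O ≫ latticeSheafTrans (inv η) X.O ≫ X.β = X.β
  have h : latticeSheafTrans η X.O ≫ latticeSheafTrans (inv η) X.O = 𝟙 _ := by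
    -- Whiskering with the structure sheaf and sheafifying are both functorial in the natural
    -- transformation.
    refine ((presheafToSheaf _ _).map_comp _ _).symm.trans ?_
    rw [← Functor.whiskerLeft_comp, IsIso.hom_inv_id, Functor.whiskerLeft_id']
    exact (presheafToSheaf _ _).map_id _
  rw [← Category.assoc, h, Category.id_comp]

end SupportedSpace

end Coh

/-! ### Comparison of the factorization conditions -/

namespace WAlg

open Coh CohSite CohSite.EOver

variable {V : AlgType.{u}}

/-- The universal property turns a factorization into a condition on one element at a time, so
localizations at arbitrary systems and at the powers of one element become comparable. -/
lemma IsLoc.exists_fac_iff {R A B : WAlg V} {S : Submonoid R} {g : R ⟶ A} (hg : IsLoc S g)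
    (h : R ⟶ B) : (∃ k, g ≫ k = h) ↔ ∀ s ∈ S, IsUnit (h.hom s) := by
  refine ⟨?_, fun hh => (hg.2 B h hh).exists⟩
  rintro ⟨k, rfl⟩ s hs
  exact (hg.1 s hs).map k.hom

lemma fac_iff {R B : WAlg V} (h : R ⟶ B) (j : EOver (finTypeLoc V) (op R)) {a : R}
    (ha : IsLoc (Submonoid.powers a) j.hom.unop) : Fac h.op j ↔ IsUnit (h.hom a) := by
  rw [← isUnit_powers_iff, ← ha.exists_fac_iff]
  exact ⟨fun ⟨m, hm⟩ => ⟨m.unop, congrArg Quiver.Hom.unop hm⟩,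
    fun ⟨k, hk⟩ => ⟨k.op, Quiver.Hom.unop_inj hk⟩⟩

/-- The change of lattices from `α₁` to `Ω₁` identifies `𝒜`-schemes with weak schemes. -/
lemma isWeakScheme_changeLattice_iff (X : SupportedSpace (radFunctor V)) :
    IsWeakScheme (zariskiSite V) ((SupportedSpace.changeLattice (omegaIsoRad V).hom).obj X) ↔
      IsAScheme (idealType V) X := by
  refine forall₃_congr fun T U h => ?_
  -- For fixed `T ⊆ U`, the condition on `𝒜`-schemes now says that every `a` whose support contains
  -- `T` restricts to a unit on `T`.
  refine Iff.trans ?_ ((isLoc_toLoc (supportSystem (idealType V) X h)).exists_fac_iff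
    (X.O.obj.map (homOfLE h).op)).symm
  constructor
  · intro H a ha
    -- An element `a` of the system is inverted on `T` because the weak condition applies to the
    -- localization at `a`, whose class has the same support as `α₂(a)`.
    let j : EOver (finTypeLoc V) (op (X.O.obj.obj (op U))) :=
      ⟨op (loc (Submonoid.powers a)), (toLoc (Submonoid.powers a)).op,
        (finTypeLoc_iff _).mpr ⟨a, isLoc_toLoc _⟩⟩
    refine (fac_iff _ j (isLoc_toLoc _)).mp (H j ?_)
    refine le_of_le_of_eq (b := X.support (RadIdl.principal a)) ha ?_
    refine Eq.trans ?_ (SupportedSpace.changeLattice_support (omegaIsoRad V).hom X _).symm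
    exact congrArg X.support (omegaIsoRad_singleClass j (isLoc_toLoc _)).symm
  · intro H j hj
    -- Conversely, `j` is the localization at `element j`, and this element belongs to the system
    -- because its support is that of `{j}`.
    refine (fac_iff _ j (isLoc_element j)).mpr (H _ ?_)
    refine le_of_le_of_eq hj ?_
    refine Eq.trans (SupportedSpace.changeLattice_support (omegaIsoRad V).hom X _) ?_
    exact congrArg X.support (omegaIsoRad_singleClass j (isLoc_element j))

/-! ### The equivalence of categories -/

variable (V) in
/-- The change of lattices from `α₁` to `Ω₁`. -/
def toOmegaSpace :
    SupportedSpace (idealType V).α₁ ⥤ SupportedSpace (omegaLattice (zariskiSite V)) :=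
  SupportedSpace.changeLattice (L' := radFunctor V) (omegaIsoRad V).hom

instance : (toOmegaSpace V).Faithful :=
  inferInstanceAs (SupportedSpace.changeLattice (omegaIsoRad V).hom).Faithful

instance : (toOmegaSpace V).Full :=
  inferInstanceAs (SupportedSpace.changeLattice (omegaIsoRad V).hom).Full

variable (V) in
/-- The functor from `𝒜`-schemes to weak schemes for the Zariski topology. -/
def toWeakScheme : AScheme (idealType V) ⥤ WeakScheme (zariskiSite V) :=
  (IsWeakScheme (zariskiSite V)).lift ((IsAScheme (idealType V)).ι ⋙ toOmegaSpace V)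
    fun X => (isWeakScheme_changeLattice_iff X.obj).mpr X.property

instance : (toWeakScheme V).Faithful where
  map_injective h := ObjectProperty.hom_ext _
    ((toOmegaSpace V).map_injective (congrArg (fun k => k.hom) h))

instance : (toWeakScheme V).Full where
  map_surjective f := by
    obtain ⟨k, hk⟩ := (toOmegaSpace V).map_surjective f.hom
    exact ⟨ObjectProperty.homMk k, ObjectProperty.hom_ext _ hk⟩

/-- A preimage is obtained by changing lattices along the inverse isomorphism. Changing back returns
the original space, whose weak scheme property therefore yields the `𝒜`-scheme property of the
preimage. -/
instance : (toWeakScheme V).EssSurj where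
  mem_essImage Y := by
    have e := SupportedSpace.changeLattice_obj_inv (omegaIsoRad V).hom Y.obj
    refine ⟨⟨(SupportedSpace.changeLattice (inv (omegaIsoRad V).hom)).obj Y.obj,
      (isWeakScheme_changeLattice_iff _).mp (e.symm ▸ Y.property)⟩,
      ⟨(IsWeakScheme (zariskiSite V)).isoMk (eqToIso e)⟩⟩

instance : (toWeakScheme V).IsEquivalence where

end WAlg

end

theorem theorem4p16 (V : AlgType.{u}) (hV : V.SelfEnhancing) :
    Nonempty (WAlg.AScheme (WAlg.idealType V) ≌ Coh.WeakScheme (WAlg.zariskiSite V)) :=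
  ⟨(WAlg.toWeakScheme V).asEquivalence⟩
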